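/- Let $n\ge 3$ be an integer and let $S^1(T)\times S^{n-1}$ be the product of a circle of length $T>0$ and the unit sphere of $\mathbb R^n$, with the product metric $g_0=dt^2+d\xi^2$. Assume $T\ge \frac{2\pi}{\sqrt{n-2}}$. Let $u$ be any smooth positive $T$-periodic solution on $\mathbb R$ ($T$ being a period, not necessarily the least one) of $$u''-\frac{(n-2)^2}{4}\,u+\frac{n(n-2)}{4}\,u^{\frac{n+2}{n-2}}=0,$$ and let $g=u^{4/(n-2)}(dt^2+d\xi^2)$ be the associated pseudo-cylindric metric on $S^1(T)\times S^{n-1}$. Then: (1) $g$ has harmonic Riemannian curvature: the divergence of its Riemann curvature tensor vanishes. (2) The Ricci tensor of $g$ is parallel if and only if $g$ is cylindrical, i.e. $g=a\,(dt^2+d\xi^2)$ for some constant $a>0$. In particular it is non-parallel for every non-cylindrical pseudo-cylindric metric. (3) $g$ is identified, up to a conformal diffeomorphism, with a Derdzinski metric: there are $S>0$, $C>0$, a smooth positive $S$-periodic function $h$ satisfying $$h''-\frac{nR}{4(n-1)}\,h^{1-4/n}=-\frac n4\,C\,h,\qquad R=(n-1)(n-2),$$ where $R$ is the scalar curvature of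 the unit sphere $S^{n-1}$, and a diffeomorphism $F:S^1(S)\times S^{n-1}\to S^1(T)\times S^{n-1}$, conformal from $\big(S^1(S)\times S^{n-1},\,dt^2+h^{4/n}(t)\,d\xi^2\big)$ to $\big(S^1(T)\times S^{n-1},\,dt^2+d\xi^2\big)$, such that $$F^*\big(u^{4/(n-2)}(dt^2+d\xi^2)\big)=dt^2+h^{4/n}(t)\,d\xi^2 .$$ Moreover $h$ is non-constant whenever $g$ is not cylindrical. -/

import Mathlib

open Set Manifold Module
open scoped ContDiff RealInnerProductSpace

noncomputable section

/-! ### Curvature in local coordinates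

`b` is a basis of the model vector space, `∂_i` is the directional derivative along `b i`, and
`G y i j` are the components of a metric at the point `y` of a coordinate domain. -/

section Coordinates

variable {ι : Type*} [Fintype ι] [DecidableEq ι]
  {E : Type*} [NormedAddCommGroup E] [NormedSpace ℝ E]

/-- The partial derivative `∂_i f`. -/
def partialDeriv (b : Basis ι ℝ E) (i : ι) (f : E → ℝ) (y : E) : ℝ :=
  fderiv ℝ f y (b i)

/-- Christoffel symbols of the second kind:
`Γ^k_{ij} = ½ g^{kl} (∂_i g_{jl} + ∂_j g_{il} - ∂_l g_{ij})`. -/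
def christoffel (b : Basis ι ℝ E) (G : E → Matrix ι ι ℝ) (k i j : ι) (y : E) : ℝ :=
  (1 / 2) * ∑ l, (G y)⁻¹ k l *
    (partialDeriv b i (fun z => G z j l) y + partialDeriv b j (fun z => G z i l) y
      - partialDeriv b l (fun z => G z i j) y)

/-- Riemann curvature tensor, `R(∂_i, ∂_j) ∂_k = R_{ijk}^l ∂_l`:
`R_{ijk}^l = ∂_i Γ^l_{jk} - ∂_j Γ^l_{ik} + Γ^l_{is} Γ^s_{jk} - Γ^l_{js} Γ^s_{ik}`. -/
def riemannCurv (b : Basis ι ℝ E) (G : E → Matrix ι ι ℝ) (l i j k : ι) (y : E) : ℝ :=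
  partialDeriv b i (christoffel b G l j k) y - partialDeriv b j (christoffel b G l i k) y
    + ∑ s, (christoffel b G l i s y * christoffel b G s j k y
      - christoffel b G l j s y * christoffel b G s i k y)

/-- Ricci tensor `Ric_{jk} = R_{ijk}^i` (trace of `X ↦ R(X, ∂_j) ∂_k`). -/
def ricciCurv (b : Basis ι ℝ E) (G : E → Matrix ι ι ℝ) (j k : ι) (y : E) : ℝ :=
  ∑ i, riemannCurv b G i i j k y

/-- Components `(D_m Ric)_{jk}` of the covariant derivative of the Ricci tensor. -/
def covDerivRicci (b : Basis ι ℝ E) (G : E → Matrix ι ι ℝ) (m j k : ι) (y : E) : ℝ :=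
  partialDeriv b m (ricciCurv b G j k) y
    - ∑ s, (christoffel b G s m j y * ricciCurv b G s k y
      + christoffel b G s m k y * ricciCurv b G j s y)

/-- Components `(D_m R)_{ijk}^l` of the covariant derivative of the curvature tensor. -/
def covDerivRiemann (b : Basis ι ℝ E) (G : E → Matrix ι ι ℝ) (m l i j k : ι) (y : E) : ℝ :=
  partialDeriv b m (riemannCurv b G l i j k) y
    + ∑ s, (christoffel b G l m s y * riemannCurv b G s i j k y
      - christoffel b G s m i y * riemannCurv b G l s j k y
      - christoffel b G s m j y * riemannCurv b G l i s k y
      - christoffel b G s m k y * riemannCurv b G l i j s y)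

/-- The divergence `D_l R_{ijk}^l` of the curvature tensor. (By the pair symmetry of the curvature
tensor a contraction with another index gives the same tensor up to order of indices and sign.) -/
def divRiemann (b : Basis ι ℝ E) (G : E → Matrix ι ι ℝ) (i j k : ι) (y : E) : ℝ :=
  ∑ l, covDerivRiemann b G l l i j k y

end Coordinates

/-! ### Metrics on manifolds -/

section Manifolds

variable {ι : Type*} [Fintype ι] [DecidableEq ι]
  {E : Type*} [NormedAddCommGroup E] [NormedSpace ℝ E]
  {H : Type*} [TopologicalSpace H] (I : ModelWithCorners ℝ E H)

/-- A field of (candidate) inner products on the tangent spaces of `M`. -/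
abbrev MetricField (M : Type*) [TopologicalSpace M] [ChartedSpace H M] : Type _ :=
  ∀ p : M, TangentSpace I p → TangentSpace I p → ℝ

variable {I} {M : Type*} [TopologicalSpace M] [ChartedSpace H M]
  {N : Type*} [TopologicalSpace N] [ChartedSpace H N]

/-- Components of the metric `g` in the chart `e`, as functions on the image of the chart:
`g_{ij}(y) = g (∂_i, ∂_j)` at the point of `M` with coordinates `y`. -/
def metricInChart (b : Basis ι ℝ E) (g : MetricField I M) (e : OpenPartialHomeomorph M H)
    (y : E) : Matrix ι ι ℝ :=
  Matrix.of fun i j => g ((e.extend I).symm y)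
    (mfderiv 𝓘(ℝ, E) I (e.extend I).symm y (b i)) (mfderiv 𝓘(ℝ, E) I (e.extend I).symm y (b j))

/-- The Riemannian curvature is harmonic: its divergence vanishes (in every chart of the atlas). -/
def HasHarmonicCurvature (b : Basis ι ℝ E) (g : MetricField I M) : Prop :=
  ∀ e ∈ atlas H M, ∀ y ∈ (e.extend I).target, ∀ i j k,
    divRiemann b (metricInChart b g e) i j k y = 0

/-- The Ricci tensor is parallel: `D Ric = 0` (in every chart of the atlas). -/
def HasParallelRicci (b : Basis ι ℝ E) (g : MetricField I M) : Prop :=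
  ∀ e ∈ atlas H M, ∀ y ∈ (e.extend I).target, ∀ m j k,
    covDerivRicci b (metricInChart b g e) m j k y = 0

/-- The pull-back `F^* g`. -/
def pullbackMetric (F : M → N) (g : MetricField I N) : MetricField I M :=
  fun p v w => g (F p) (mfderiv I I F p v) (mfderiv I I F p w)

/-- The diffeomorphism `F` from `(M, g)` to `(N, h)` is conformal: `F^* h = φ g` for a smooth
positive function `φ`. -/
def IsConformalDiffeo (F : M ≃ₘ⟮I, I⟯ N) (g : MetricField I M) (h : MetricField I N) : Prop :=
  ∃ φ : M → ℝ, ContMDiff I 𝓘(ℝ, ℝ) ∞ φ ∧ (∀ p, 0 < φ p) ∧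
    ∀ p v w, pullbackMetric F h p v w = φ p * g p v w

end Manifolds

/-! ### The circle of length `T` as a manifold

The charts of `ℝ / Tℤ` are the inverses of the quotient map `ℝ → ℝ / Tℤ` restricted to the open
intervals of length `T`. The changes of charts are locally translations. -/

section Circle

variable (T : ℝ) [Fact (0 < T)]

instance circleChartedSpace : ChartedSpace ℝ (AddCircle T) where
  atlas := {e | ∃ a : ℝ, e = (AddCircle.openPartialHomeomorphCoe T a).symm}
  chartAt x := (AddCircle.openPartialHomeomorphCoe T
    ((AddCircle.equivIco T 0 x : ℝ) - T / 2)).symm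
  mem_chart_source x := by
    have hT : 0 < T := Fact.out
    set c : ℝ := (AddCircle.equivIco T 0 x : ℝ) with hc
    have hx : (c : AddCircle T) = x := AddCircle.coe_equivIco
    have h := (AddCircle.openPartialHomeomorphCoe T (c - T / 2)).map_source (x := c)
      (show c ∈ Ioo (c - T / 2) (c - T / 2 + T) from ⟨by linarith, by linarith⟩)
    rw [← hx]
    exact h
  chart_mem_atlas x := ⟨_, rfl⟩

instance circleIsManifold : IsManifold 𝓘(ℝ, ℝ) ω (AddCircle T) := by
  apply isManifold_of_contDiffOn
  rintro _ _ ⟨a, rfl⟩ ⟨a', rfl⟩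
  rw [modelWithCornersSelf_coe, modelWithCornersSelf_coe_symm]
  simp only [preimage_id, range_id, inter_univ, Function.comp_id, Function.id_comp]
  set e := (AddCircle.openPartialHomeomorphCoe T a)
  set e' := (AddCircle.openPartialHomeomorphCoe T a')
  intro y hy
  have hT : 0 < T := Fact.out
  have hdiff : ∀ z, ∃ k : ℤ, e'.symm (e z) - z = k * T := by
    intro z
    have h : ((e'.symm (e z) : ℝ) : AddCircle T) = (z : AddCircle T) :=
      AddCircle.coe_equivIco (p := T) (a := a') (y := (z : AddCircle T))
    rw [← sub_eq_zero, ← AddCircle.coe_sub, AddCircle.coe_eq_zero_iff] at h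
    obtain ⟨k, hk⟩ := h
    exact ⟨k, by rw [← hk]; simp⟩
  have hcont : ContinuousAt (fun z => e'.symm (e z) - z) y :=
    ((e ≫ₕ e'.symm).continuousAt hy).sub continuousAt_id
  have hev : (fun z => e'.symm (e z)) =ᶠ[nhds y] fun z => z + (e'.symm (e y) - y) := by
    filter_upwards [Metric.continuousAt_iff'.1 hcont T hT] with z hz
    obtain ⟨k, hk⟩ := hdiff z
    obtain ⟨l, hl⟩ := hdiff y
    rw [Real.dist_eq, hk, hl, ← sub_mul, abs_mul, abs_of_pos hT] at hz
    have h1 : |(k : ℝ) - l| < 1 := by nlinarith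
    have h2 : k = l := by
      rw [← sub_eq_zero, ← Int.abs_lt_one_iff]
      exact_mod_cast h1
    rw [hl, ← h2, ← hk]
    ring
  exact ((contDiffAt_id.add contDiffAt_const).congr_of_eventuallyEq hev).contDiffWithinAt

end Circle

/-! ### The cylinder `S¹(T) × S^m` and its metrics -/

section Cylinder

/-- The unit sphere `S^m` of `ℝ^{m+1}`. -/
abbrev UnitSphere (m : ℕ) : Type := Metric.sphere (0 : EuclideanSpace ℝ (Fin (m + 1))) 1

/-- `S¹(T) × S^m`, the product of the circle of length `T` and the unit sphere. -/
abbrev Cylinder (m : ℕ) (T : ℝ) : Type := AddCircle T × UnitSphere m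

/-- The model with corners of `S¹(T) × S^m`. -/
abbrev cylModel (m : ℕ) := (𝓘(ℝ, ℝ)).prod (𝓡 m)

/-- The standard basis of `ℝ × ℝ^m`. -/
def cylBasis (m : ℕ) : Basis (Unit ⊕ Fin m) ℝ (ℝ × EuclideanSpace ℝ (Fin m)) :=
  (Basis.singleton Unit ℝ).prod (EuclideanSpace.basisFun (Fin m) ℝ).toBasis

variable {m : ℕ} {T : ℝ} [Fact (0 < T)]

/-- The metric `dt²` of `S¹(T)`. Charts of `S¹(T)` differ by translations, so that the coordinate
of a tangent vector `a` in the chart at `x`, which is `a` itself, is `dt(a)`. -/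
def circleMetric : MetricField 𝓘(ℝ, ℝ) (AddCircle T) :=
  fun _ a b => (show ℝ from a) * (show ℝ from b)

/-- The round metric `dξ²` of `S^m`, induced by the inclusion in `ℝ^{m+1}`. -/
def roundMetric : MetricField (𝓡 m) (UnitSphere m) :=
  fun ξ v w => ⟪mvfderiv (𝓡 m) ((↑) : UnitSphere m → EuclideanSpace ℝ (Fin (m + 1))) ξ v,
    mvfderiv (𝓡 m) ((↑) : UnitSphere m → EuclideanSpace ℝ (Fin (m + 1))) ξ w⟫

/-- The metric `A(t) dt² + B(t) dξ²` on `S¹(T) × S^m`. -/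
def rotMetric (A B : AddCircle T → ℝ) : MetricField (cylModel m) (Cylinder m T) :=
  fun p v w =>
    A p.1 * circleMetric p.1
        (mfderiv (cylModel m) 𝓘(ℝ, ℝ) Prod.fst p v) (mfderiv (cylModel m) 𝓘(ℝ, ℝ) Prod.fst p w)
    + B p.1 * roundMetric p.2
        (mfderiv (cylModel m) (𝓡 m) Prod.snd p v) (mfderiv (cylModel m) (𝓡 m) Prod.snd p w)

/-- The product (cylindrical) metric `g₀ = dt² + dξ²`. -/
def productMetric (m : ℕ) (T : ℝ) [Fact (0 < T)] : MetricField (cylModel m) (Cylinder m T) :=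
  rotMetric (fun _ => 1) (fun _ => 1)

end Cylinder

/-! ### Pseudo-cylindric and Derdzinski metrics in dimension `n` -/

/-- `u` is a smooth positive `T`-periodic solution of
`u'' - (n-2)²/4 u + n(n-2)/4 u^{(n+2)/(n-2)} = 0`. -/
structure IsPseudoCylindricFactor (n : ℕ) (T : ℝ) (u : ℝ → ℝ) : Prop where
  smooth : ContDiff ℝ ∞ u
  pos : ∀ t, 0 < u t
  periodic : Function.Periodic u T
  ode : ∀ t, deriv (deriv u) t - ((n : ℝ) - 2) ^ 2 / 4 * u t
    + (n : ℝ) * ((n : ℝ) - 2) / 4 * u t ^ (((n : ℝ) + 2) / ((n : ℝ) - 2)) = 0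

/-- The pseudo-cylindric metric `u^{4/(n-2)} (dt² + dξ²)` on `S¹(T) × S^{n-1}`. -/
def pseudoCylindricMetric {n : ℕ} {T : ℝ} [Fact (0 < T)] {u : ℝ → ℝ}
    (hu : IsPseudoCylindricFactor n T u) : MetricField (cylModel (n - 1)) (Cylinder (n - 1) T) :=
  rotMetric (fun x => hu.periodic.lift x ^ (4 / ((n : ℝ) - 2)))
    (fun x => hu.periodic.lift x ^ (4 / ((n : ℝ) - 2)))

/-- `h` is a smooth positive `S`-periodic solution of the Derdzinski equation
`h'' - nR/(4(n-1)) h^{1-4/n} = -(n/4) C h`, with `R = (n-1)(n-2)` the scalar curvature of the unit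
sphere `S^{n-1}`. -/
structure IsDerdzinskiFactor (n : ℕ) (C S : ℝ) (h : ℝ → ℝ) : Prop where
  smooth : ContDiff ℝ ∞ h
  pos : ∀ s, 0 < h s
  periodic : Function.Periodic h S
  ode : ∀ s, deriv (deriv h) s
    - (n : ℝ) * (((n : ℝ) - 1) * ((n : ℝ) - 2)) / (4 * ((n : ℝ) - 1))
      * h s ^ (1 - 4 / (n : ℝ)) = -((n : ℝ) / 4) * C * h s

/-- The Derdzinski warped product metric `dt² + h^{4/n}(t) dξ²` on `S¹(S) × S^{n-1}`. -/
def derdzinskiMetric {n : ℕ} {C S : ℝ} [Fact (0 < S)] {h : ℝ → ℝ}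
    (hh : IsDerdzinskiFactor n C S h) : MetricField (cylModel (n - 1)) (Cylinder (n - 1) S) :=
  rotMetric (fun _ => 1) (fun x => hh.periodic.lift x ^ (4 / (n : ℝ)))

/-- `g` is cylindrical: a constant multiple of `dt² + dξ²`. -/
def IsCylindrical {m : ℕ} {T : ℝ} [Fact (0 < T)]
    (g : MetricField (cylModel m) (Cylinder m T)) : Prop :=
  ∃ a : ℝ, 0 < a ∧ ∀ p v w, g p v w = a * productMetric m T p v w

end

/-! Stereographic charts on the sphere and translation charts on the circle put every metric of the
family in the form `A(t) (dt² + Φ(x) dx²)`. Write `p = A'/(2A)`, `q = -p'` and `K = 1 - p²`. The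
planes containing `∂_t` have sectional curvature `q/A` and the planes tangent to the sphere have
`K/A`, so every curvature question becomes a relation between `p`, `q` and `A`.

For `A = u^{4/(n-2)}` the equation for `u` says `n A = 2 q + (n-2) K`, that is, the scalar curvature
is the constant `n(n-1)` (`hasDerivAt_logSlope`). The divergence of the curvature tensor vanishes
once `q' = -(m-3) p q + (m-1) p K` with `m = n-1` (`sum_cylRiemCov`), and this is the derivative of
the preceding relation.

The mixed component of `D Ric` is a non-zero multiple of `p (q - K)`. If `D Ric = 0` and `p ≠ 0` at
some point, then `K = A` there, so the first integral `(K - A) u²` is zero and `K = A = q`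
everywhere. Then `p' = -A < 0`, which is impossible for a periodic `p` (`logSlope_eq_zero`). Hence
`p = 0` and `A` is constant; conversely, a constant `A` gives a product with parallel Ricci tensor.

For the Derdzinski form, the circle is reparametrized by the arclength `σ = ∫ u^{2/(n-2)}`. With `τ
= σ⁻¹` and `h = (u ∘ τ)^{n/(n-2)}` the metric becomes `ds² + h^{4/n} dξ²`, and the equation for `u`
becomes the Derdzinski equation with `C = n` (`exists_arclength`, `isDerdzinskiFactor`). -/

noncomputable section

/-! ### Pointwise tensor algebra of `A (dt² + Φ dx²)`, with derivatives as free parameters. -/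

section Algebra

variable {m : ℕ}

/-- The Kronecker symbol. -/
def kron (a b : Fin m) : ℝ := if a = b then 1 else 0

theorem kron_comm (a b : Fin m) : kron a b = kron b a := by
  simp [kron, eq_comm]

@[simp] theorem kron_self (a : Fin m) : kron a a = 1 := by simp [kron]

@[simp] theorem sum_kron_mul (a : Fin m) (f : Fin m → ℝ) : ∑ s, kron a s * f s = f a := by
  simp [kron]

@[simp] theorem sum_kron_mul' (a : Fin m) (f : Fin m → ℝ) : ∑ s, kron s a * f s = f a := by
  simp [kron]

@[simp] theorem sum_mul_mul_kron (a : Fin m) (c : ℝ) (f : Fin m → ℝ) :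
    ∑ s, f s * (c * kron a s) = c * f a := by
  simp [kron, mul_comm]

@[simp] theorem sum_mul_mul_kron' (a : Fin m) (c : ℝ) (f : Fin m → ℝ) :
    ∑ s, f s * (c * kron s a) = c * f a := by
  simp [kron, mul_comm]

@[simp] theorem sum_mul_mul_mul_kron (a : Fin m) (c d : ℝ) (f : Fin m → ℝ) :
    ∑ s, f s * (c * (d * kron a s)) = c * (d * f a) := by
  simp [kron, mul_comm, mul_left_comm]

/-- Christoffel symbols of a conformally round cylinder, with `β = ρ'/ρ`, `α = Φ β`, where the
metric is `ρ² (dt² + Φ dx²)` and `ψ` is the gradient of `½ log Φ`. -/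
def cylGamma (α β : ℝ) (ψ : Fin m → ℝ) : (k i j : Unit ⊕ Fin m) → ℝ
  | .inl _, .inl _, .inl _ => β
  | .inl _, .inr a, .inr b => -(α * kron a b)
  | .inr c, .inl _, .inr b => β * kron c b
  | .inr c, .inr a, .inl _ => β * kron c a
  | .inr c, .inr a, .inr b => kron c b * ψ a + kron c a * ψ b - kron a b * ψ c
  | .inl _, .inl _, .inr _ => 0
  | .inl _, .inr _, .inl _ => 0
  | .inr _, .inl _, .inl _ => 0

/-- Curvature tensor of a conformally round cylinder. -/
def cylRiem (α β γ : ℝ) : (l i j k : Unit ⊕ Fin m) → ℝ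
  | .inl _, .inl _, .inr a, .inr b => α * kron a b
  | .inl _, .inr a, .inl _, .inr b => -(α * kron a b)
  | .inr d, .inr a, .inl _, .inl _ => β * kron d a
  | .inr d, .inl _, .inr a, .inl _ => -(β * kron d a)
  | .inr d, .inr a, .inr b, .inr c => γ * (kron d a * kron b c - kron d b * kron a c)
  | .inl _, .inl _, .inl _, _ => 0
  | .inl _, .inl _, .inr _, .inl _ => 0
  | .inl _, .inr _, .inl _, .inl _ => 0
  | .inl _, .inr _, .inr _, _ => 0
  | .inr _, .inl _, .inl _, _ => 0
  | .inr _, .inr _, .inl _, .inr _ => 0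
  | .inr _, .inl _, .inr _, .inr _ => 0
  | .inr _, .inr _, .inr _, .inl _ => 0

/-- Ricci tensor of a conformally round cylinder. -/
def cylRic (α β : ℝ) : (j k : Unit ⊕ Fin m) → ℝ
  | .inl _, .inl _ => α
  | .inr a, .inr b => β * kron a b
  | .inl _, .inr _ => 0
  | .inr _, .inl _ => 0

theorem sum_cylGamma_upper (α β : ℝ) (ψ V : Fin m → ℝ) (c a : Fin m) :
    ∑ s, cylGamma α β ψ (.inr c) (.inr a) (.inr s) * V s
      = ψ a * V c + kron c a * ∑ s, ψ s * V s - ψ c * V a := by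
  have h : ∀ s, cylGamma α β ψ (.inr c) (.inr a) (.inr s) * V s
      = kron c s * (ψ a * V s) + kron c a * (ψ s * V s) - kron a s * (ψ c * V s) := fun s => by
    simp only [cylGamma]; ring
  simp only [h, Finset.sum_add_distrib, Finset.sum_sub_distrib, sum_kron_mul, ← Finset.mul_sum]

theorem sum_cylGamma_lower (α β : ℝ) (ψ W : Fin m → ℝ) (a b : Fin m) :
    ∑ s, cylGamma α β ψ (.inr s) (.inr a) (.inr b) * W s
      = ψ a * W b + ψ b * W a - kron a b * ∑ s, ψ s * W s := by
  have h : ∀ s, cylGamma α β ψ (.inr s) (.inr a) (.inr b) * W s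
      = kron s b * (ψ a * W s) + kron s a * (ψ b * W s) - kron a b * (ψ s * W s) := fun s => by
    simp only [cylGamma]; ring
  simp only [h, Finset.sum_add_distrib, Finset.sum_sub_distrib, sum_kron_mul', ← Finset.mul_sum]

theorem sum_mul_cylGamma_lower (α β : ℝ) (ψ W : Fin m → ℝ) (a b : Fin m) :
    ∑ s, W s * cylGamma α β ψ (.inr s) (.inr a) (.inr b)
      = ψ a * W b + ψ b * W a - kron a b * ∑ s, ψ s * W s := by
  simp only [← sum_cylGamma_lower α β, mul_comm]

/-- The partial derivatives of the Christoffel symbols of a conformally round cylinder. -/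
def cylGammaDeriv (Φ p p' σ : ℝ) (ψ : Fin m → ℝ) : (i : Unit ⊕ Fin m) → (l j k : Unit ⊕ Fin m) → ℝ
  | .inl _ => cylGamma (Φ * p') p' 0
  | .inr a => cylGamma (2 * Φ * ψ a * p) 0 (fun b => ψ a * ψ b - σ * kron a b)

/-- The curvature tensor computed from Christoffel symbols; the hypothesis says that the sphere
has curvature `1`. -/
theorem cylRiem_eq (Φ p p' σ : ℝ) (ψ : Fin m → ℝ) (hσ : 2 * σ - ∑ s, ψ s * ψ s = Φ)
    (l i j k : Unit ⊕ Fin m) :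
    cylGammaDeriv Φ p p' σ ψ i l j k - cylGammaDeriv Φ p p' σ ψ j l i k
      + ∑ s, (cylGamma (Φ * p) p ψ l i s * cylGamma (Φ * p) p ψ s j k
        - cylGamma (Φ * p) p ψ l j s * cylGamma (Φ * p) p ψ s i k)
    = cylRiem (-p' * Φ) (-p') ((1 - p ^ 2) * Φ) l i j k := by
  have hσ' : ∑ s, ψ s * ψ s = 2 * σ - Φ := by linarith
  rcases l with ⟨⟩ | l <;> rcases i with ⟨⟩ | i <;> rcases j with ⟨⟩ | j <;> rcases k with ⟨⟩ | k <;>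
    simp only [Fintype.sum_sum_type, Finset.univ_unique, Finset.sum_singleton,
      Finset.sum_sub_distrib, sum_cylGamma_upper, sum_mul_cylGamma_lower]
  all_goals simp only [cylGammaDeriv, cylGamma, cylRiem, hσ', Finset.sum_const_zero, zero_mul,
    mul_zero, neg_mul, mul_neg, Finset.sum_neg_distrib, sum_mul_mul_kron, sum_mul_mul_mul_kron,
    mul_assoc, mul_left_comm _ (kron _ _), sum_kron_mul, Pi.zero_apply, kron_comm]
  all_goals ring


/-- The partial derivatives of the curvature tensor of a conformally round cylinder. -/
def cylRiemDeriv (Φ q q' k k' : ℝ) (ψ : Fin m → ℝ) :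
    (i : Unit ⊕ Fin m) → (l i j k : Unit ⊕ Fin m) → ℝ
  | .inl _ => cylRiem (q' * Φ) q' (k' * Φ)
  | .inr a => cylRiem (q * (2 * Φ * ψ a)) 0 (k * (2 * Φ * ψ a))

/-- Components of the covariant derivative of the curvature tensor of a conformally round
cylinder, in terms of the derivatives `q'` and `K'` of its two sectional curvatures (up to scale). -/
def cylRiemCov (Φ p q q' K K' : ℝ) (ψ : Fin m → ℝ) (e l i j k : Unit ⊕ Fin m) : ℝ :=
  cylRiemDeriv Φ q q' K K' ψ e l i j k
    + ∑ s, (cylGamma (Φ * p) p ψ l e s * cylRiem (q * Φ) q (K * Φ) s i j k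
      - cylGamma (Φ * p) p ψ s e i * cylRiem (q * Φ) q (K * Φ) l s j k
      - cylGamma (Φ * p) p ψ s e j * cylRiem (q * Φ) q (K * Φ) l i s k
      - cylGamma (Φ * p) p ψ s e k * cylRiem (q * Φ) q (K * Φ) l i j s)

/-- The `t`-direction term of the divergence: only the mixed-plane curvature survives, through `q' -
2pq`. -/
theorem cylRiemCov_inl (Φ p q q' K K' : ℝ) (ψ : Fin m → ℝ) (i j k : Unit ⊕ Fin m) :
    cylRiemCov Φ p q q' K K' ψ (.inl ()) (.inl ()) i j k
      = cylRiem ((q' - 2 * p * q) * Φ) 0 0 (.inl ()) i j k := by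
  rcases i with ⟨⟩ | i <;> rcases j with ⟨⟩ | j <;> rcases k with ⟨⟩ | k <;>
    simp only [cylRiemCov, Fintype.sum_sum_type, Finset.univ_unique, Finset.sum_singleton,
      cylRiemDeriv, cylGamma, cylRiem, Finset.sum_const_zero, zero_mul, mul_zero, mul_neg,
      Finset.sum_neg_distrib, Finset.sum_sub_distrib, mul_assoc, mul_left_comm _ (kron _ _),
      sum_kron_mul']
  all_goals ring

theorem sum_mul_cylRiem_one (α β γ : ℝ) (ψ : Fin m → ℝ) (a b c : Fin m) :
    ∑ s, ψ s * cylRiem α β γ (.inr s) (.inr a) (.inr b) (.inr c)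
      = γ * (ψ a * kron b c - ψ b * kron a c) := by
  rw [← sum_kron_mul' a ψ, ← sum_kron_mul' b ψ, Finset.sum_mul, Finset.sum_mul,
    ← Finset.sum_sub_distrib, Finset.mul_sum]
  exact Finset.sum_congr rfl fun s _ => by simp only [cylRiem]; ring

theorem sum_mul_cylRiem_two (α β γ : ℝ) (ψ : Fin m → ℝ) (d b c : Fin m) :
    ∑ s, ψ s * cylRiem α β γ (.inr d) (.inr s) (.inr b) (.inr c)
      = γ * (ψ d * kron b c - kron d b * ψ c) := by
  rw [← sum_kron_mul d ψ, ← sum_kron_mul' c ψ, Finset.sum_mul, Finset.mul_sum,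
    ← Finset.sum_sub_distrib, Finset.mul_sum]
  exact Finset.sum_congr rfl fun s _ => by simp only [cylRiem]; ring

theorem sum_mul_cylRiem_three (α β γ : ℝ) (ψ : Fin m → ℝ) (d a c : Fin m) :
    ∑ s, ψ s * cylRiem α β γ (.inr d) (.inr a) (.inr s) (.inr c)
      = γ * (kron d a * ψ c - ψ d * kron a c) := by
  rw [← sum_kron_mul d ψ, ← sum_kron_mul' c ψ, Finset.sum_mul, Finset.mul_sum,
    ← Finset.sum_sub_distrib, Finset.mul_sum]
  exact Finset.sum_congr rfl fun s _ => by simp only [cylRiem]; ring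

theorem sum_mul_cylRiem_four (α β γ : ℝ) (ψ : Fin m → ℝ) (d a b : Fin m) :
    ∑ s, ψ s * cylRiem α β γ (.inr d) (.inr a) (.inr b) (.inr s)
      = γ * (kron d a * ψ b - kron d b * ψ a) := by
  rw [← sum_kron_mul b ψ, ← sum_kron_mul a ψ, Finset.mul_sum, Finset.mul_sum,
    ← Finset.sum_sub_distrib, Finset.mul_sum]
  exact Finset.sum_congr rfl fun s _ => by simp only [cylRiem]; ring

theorem sum_mul_kron_mul' (a : Fin m) (c : ℝ) (f : Fin m → ℝ) :
    ∑ s, c * kron s a * f s = c * f a := by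
  simp [kron]

/-- The part of the divergence of `cylRiem` that involves the `d`-th space direction. -/
def cylRiemDivTerm (c : ℝ) (d : Fin m) : (i j k : Unit ⊕ Fin m) → ℝ
  | .inl _, .inr a, .inr b => c * (kron a b - kron d a * kron d b)
  | .inr a, .inl _, .inr b => -(c * (kron a b - kron d a * kron d b))
  | .inl _, .inl _, _ => 0
  | .inl _, .inr _, .inl _ => 0
  | .inr _, .inl _, .inl _ => 0
  | .inr _, .inr _, _ => 0

/-- All terms in `ψ` cancel, as the sphere's own curvature tensor is parallel; what remains is the
difference `q - K` of the two curvatures, coupled by the Christoffel symbols in `p`. -/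
theorem cylRiemCov_inr (Φ p q q' K K' : ℝ) (ψ : Fin m → ℝ) (d : Fin m) (i j k : Unit ⊕ Fin m) :
    cylRiemCov Φ p q q' K K' ψ (.inr d) (.inr d) i j k
      = cylRiemDivTerm (Φ * p * (q - K)) d i j k := by
  rcases i with ⟨⟩ | i <;> rcases j with ⟨⟩ | j <;> rcases k with ⟨⟩ | k <;>
    simp only [cylRiemCov, Fintype.sum_sum_type, Finset.univ_unique, Finset.sum_singleton,
      Finset.sum_sub_distrib, sum_cylGamma_upper, sum_cylGamma_lower,
      sum_mul_cylRiem_one, sum_mul_cylRiem_two, sum_mul_cylRiem_three, sum_mul_cylRiem_four]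
  all_goals simp only [cylRiemDeriv, cylGamma, sum_mul_kron_mul']
  all_goals simp only [cylRiem, Finset.sum_const_zero, zero_mul, mul_zero, neg_mul, mul_neg,
    Finset.sum_neg_distrib, sum_mul_mul_kron, sum_mul_mul_kron', kron_self, cylRiemDivTerm]
  all_goals (try simp only [kron_comm]); ring

/-- The `t` term contributes `q' - 2pq` and the `m` sphere directions together contribute `(m-1) p
(q - K)`, each with the factor `Φ`. The hypothesis `hq` is exactly the vanishing of their sum. -/
theorem sum_cylRiemCov (Φ p q q' K K' : ℝ) (ψ : Fin m → ℝ)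
    (hq : q' = -(m - 3) * p * q + (m - 1) * p * K) (i j k : Unit ⊕ Fin m) :
    ∑ l, cylRiemCov Φ p q q' K K' ψ l l i j k = 0 := by
  simp only [Fintype.sum_sum_type, Finset.univ_unique, Finset.sum_singleton,
    PUnit.default_eq_unit, cylRiemCov_inl, cylRiemCov_inr]
  rcases i with ⟨⟩ | i <;> rcases j with ⟨⟩ | j <;> rcases k with ⟨⟩ | k <;>
    simp only [cylRiem, cylRiemDivTerm, Finset.sum_const_zero, Finset.sum_neg_distrib,
      ← Finset.mul_sum, Finset.sum_sub_distrib, sum_kron_mul', Finset.sum_const, Finset.card_univ,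
      Fintype.card_fin, nsmul_eq_mul, add_zero, hq]
  all_goals ring

/-- Ricci is the trace of the curvature tensor. -/
theorem sum_cylRiem (α β γ : ℝ) (j k : Unit ⊕ Fin m) :
    ∑ i, cylRiem α β γ i i j k = cylRic (m * β) (α + (m - 1) * γ) j k := by
  rcases j with ⟨⟩ | j <;> rcases k with ⟨⟩ | k <;>
    simp only [Fintype.sum_sum_type, Finset.univ_unique, cylRiem, cylRic,
      Finset.sum_const_zero, ← Finset.mul_sum, Finset.sum_sub_distrib, sum_kron_mul', kron_self,
      Finset.sum_const, Finset.card_univ, Fintype.card_fin, Finset.card_singleton, nsmul_eq_mul,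
      Nat.cast_one]
  all_goals ring

/-- The Ricci tensor of the round cylinder is parallel. -/
theorem cylRic_parallel_of_product (Φ r : ℝ) (ψ : Fin m → ℝ) (e j k : Unit ⊕ Fin m) :
    (Sum.elim (fun _ => 0) (fun a => cylRic 0 (r * (2 * Φ * ψ a)) j k) e : ℝ)
      - ∑ s, (cylGamma 0 0 ψ s e j * cylRic 0 (r * Φ) s k
        + cylGamma 0 0 ψ s e k * cylRic 0 (r * Φ) j s) = 0 := by
  rcases e with ⟨⟩ | e <;> rcases j with ⟨⟩ | j <;> rcases k with ⟨⟩ | k <;>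
    simp only [Fintype.sum_sum_type, Finset.univ_unique, Finset.sum_singleton,
      Finset.sum_add_distrib, sum_cylGamma_lower, Sum.elim_inl, Sum.elim_inr]
  all_goals simp only [cylGamma, cylRic, sum_mul_mul_kron,
    Finset.sum_const_zero, mul_zero, zero_mul, kron_comm]
  all_goals ring

theorem sum_cylGamma_cylRic (Φ p α β : ℝ) (ψ : Fin m → ℝ) (a b : Fin m) :
    ∑ s, (cylGamma (Φ * p) p ψ s (.inr a) (.inl ()) * cylRic α β s (.inr b)
        + cylGamma (Φ * p) p ψ s (.inr a) (.inr b) * cylRic α β (.inl ()) s)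
      = p * (β - Φ * α) * kron a b := by
  simp only [Fintype.sum_sum_type, Finset.univ_unique, Finset.sum_singleton,
    Finset.sum_add_distrib, cylGamma, cylRic, sum_mul_kron_mul', Finset.sum_const_zero, mul_zero]
  ring

end Algebra

/-! ### Calculus of partial derivatives in the coordinates `(t, x)`. -/

section Partials

variable {m : ℕ}

/-- `F` is differentiable at `y`, with partial derivatives `D`. -/
def HasPartials (F : ℝ × EuclideanSpace ℝ (Fin m) → ℝ) (D : Unit ⊕ Fin m → ℝ)
    (y : ℝ × EuclideanSpace ℝ (Fin m)) : Prop :=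
  DifferentiableAt ℝ F y ∧ ∀ i, partialDeriv (cylBasis m) i F y = D i

variable {F F' : ℝ × EuclideanSpace ℝ (Fin m) → ℝ} {D D' : Unit ⊕ Fin m → ℝ}
  {y : ℝ × EuclideanSpace ℝ (Fin m)}

theorem HasPartials.congr_deriv (h : HasPartials F D y) (hD : ∀ i, D i = D' i) :
    HasPartials F D' y :=
  ⟨h.1, fun i => (h.2 i).trans (hD i)⟩

theorem hasPartials_const (c : ℝ) : HasPartials (fun _ => c) 0 y :=
  ⟨differentiableAt_const c, fun i => by simp [partialDeriv]⟩

theorem HasPartials.add (h : HasPartials F D y) (h' : HasPartials F' D' y) :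
    HasPartials (fun z => F z + F' z) (fun i => D i + D' i) y :=
  ⟨h.1.add h'.1, fun i => by
    simp only [← h.2, ← h'.2, partialDeriv, fderiv_fun_add h.1 h'.1]; rfl⟩

theorem HasPartials.neg (h : HasPartials F D y) :
    HasPartials (fun z => -F z) (fun i => -D i) y :=
  ⟨h.1.neg, fun i => by simp only [← h.2, partialDeriv, fderiv_fun_neg]; rfl⟩

theorem HasPartials.sub (h : HasPartials F D y) (h' : HasPartials F' D' y) :
    HasPartials (fun z => F z - F' z) (fun i => D i - D' i) y :=
  ⟨h.1.sub h'.1, fun i => by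
    simp only [← h.2, ← h'.2, partialDeriv, fderiv_fun_sub h.1 h'.1]; rfl⟩

theorem HasPartials.mul (h : HasPartials F D y) (h' : HasPartials F' D' y) :
    HasPartials (fun z => F z * F' z) (fun i => D i * F' y + F y * D' i) y :=
  ⟨h.1.mul h'.1, fun i => by
    simp only [← h.2, ← h'.2, partialDeriv, fderiv_fun_mul h.1 h'.1, add_apply,
      smul_apply, smul_eq_mul]
    ring⟩

theorem HasPartials.mul_const (h : HasPartials F D y) (c : ℝ) :
    HasPartials (fun z => F z * c) (fun i => D i * c) y :=
  (h.mul (hasPartials_const c)).congr_deriv fun i => by simp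

theorem cylBasis_inl (i : Unit) : cylBasis m (.inl i) = (1, 0) := by
  simp [cylBasis]

theorem cylBasis_inr (a : Fin m) : cylBasis m (.inr a) = (0, EuclideanSpace.single a 1) := by
  simp [cylBasis]

theorem HasDerivAt.hasPartials {f : ℝ → ℝ} {f' : ℝ} (h : HasDerivAt f f' y.1) :
    HasPartials (fun z => f z.1) (Sum.elim (fun _ => f') (fun _ => 0)) y := by
  have h1 := h.hasFDerivAt.comp y (hasFDerivAt_fst (𝕜 := ℝ) (p := y))
  refine ⟨h1.differentiableAt, ?_⟩
  rintro (⟨⟩ | a)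
  · simp only [partialDeriv, cylBasis_inl]
    erw [h1.fderiv]
    simp
  · simp only [partialDeriv, cylBasis_inr]
    erw [h1.fderiv]
    simp

theorem HasFDerivAt.hasPartials {f : EuclideanSpace ℝ (Fin m) → ℝ}
    {f' : EuclideanSpace ℝ (Fin m) →L[ℝ] ℝ} (h : HasFDerivAt f f' y.2) :
    HasPartials (fun z => f z.2)
      (Sum.elim (fun _ => 0) (fun a => f' (EuclideanSpace.single a 1))) y := by
  have h1 := h.comp y (hasFDerivAt_snd (𝕜 := ℝ) (p := y))
  refine ⟨h1.differentiableAt, ?_⟩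
  rintro (⟨⟩ | a)
  · simp only [partialDeriv, cylBasis_inl]
    erw [h1.fderiv]
    simp
  · simp only [partialDeriv, cylBasis_inr]
    erw [h1.fderiv]
    simp

/-- The symbols are linear in `α`, `β`, `ψ` with constant coefficients, so differentiation only
replaces these parameters by their derivatives. This is why `cylGammaDeriv` can be written with
`cylGamma` itself. -/
theorem HasPartials.cylGamma {α β : ℝ × EuclideanSpace ℝ (Fin m) → ℝ} {Dα Dβ : Unit ⊕ Fin m → ℝ}
    {ψ : ℝ × EuclideanSpace ℝ (Fin m) → Fin m → ℝ} {Dψ : Unit ⊕ Fin m → Fin m → ℝ}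
    (hα : HasPartials α Dα y) (hβ : HasPartials β Dβ y)
    (hψ : ∀ b, HasPartials (fun z => ψ z b) (fun i => Dψ i b) y) (k i j : Unit ⊕ Fin m) :
    HasPartials (fun z => cylGamma (α z) (β z) (ψ z) k i j)
      (fun e => cylGamma (Dα e) (Dβ e) (Dψ e) k i j) y := by
  rcases k with ⟨⟩ | k <;> rcases i with ⟨⟩ | i <;> rcases j with ⟨⟩ | j <;>
    simp only [_root_.cylGamma]
  · exact hβ
  · exact hasPartials_const 0
  · exact hasPartials_const 0
  · exact (hα.mul_const _).neg
  · exact hasPartials_const 0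
  · exact hβ.mul_const _
  · exact hβ.mul_const _
  · simpa only [mul_comm] using
      (((hψ i).mul_const (kron k j)).add ((hψ j).mul_const (kron k i))).sub
        ((hψ k).mul_const (kron i j))

theorem HasPartials.cylRiem {α β γ : ℝ × EuclideanSpace ℝ (Fin m) → ℝ}
    {Dα Dβ Dγ : Unit ⊕ Fin m → ℝ} (hα : HasPartials α Dα y) (hβ : HasPartials β Dβ y)
    (hγ : HasPartials γ Dγ y) (l i j k : Unit ⊕ Fin m) :
    HasPartials (fun z => cylRiem (α z) (β z) (γ z) l i j k)
      (fun e => cylRiem (Dα e) (Dβ e) (Dγ e) l i j k) y := by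
  rcases l with ⟨⟩ | l <;> rcases i with ⟨⟩ | i <;> rcases j with ⟨⟩ | j <;> rcases k with ⟨⟩ | k <;>
    simp only [_root_.cylRiem] <;>
    first
      | exact hasPartials_const 0
      | exact hα.mul_const _
      | exact (hα.mul_const _).neg
      | exact hβ.mul_const _
      | exact (hβ.mul_const _).neg
      | exact hγ.mul_const _

theorem HasPartials.cylRic {α β : ℝ × EuclideanSpace ℝ (Fin m) → ℝ}
    {Dα Dβ : Unit ⊕ Fin m → ℝ} (hα : HasPartials α Dα y) (hβ : HasPartials β Dβ y)
    (j k : Unit ⊕ Fin m) :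
    HasPartials (fun z => cylRic (α z) (β z) j k) (fun e => cylRic (Dα e) (Dβ e) j k) y := by
  rcases j with ⟨⟩ | j <;> rcases k with ⟨⟩ | k <;> simp only [_root_.cylRic] <;>
    first
      | exact hasPartials_const 0
      | exact hα
      | exact hβ.mul_const _

end Partials

/-! ### Curvature of `A(t) (dt² + Φ dx²)` as functions of the coordinates. -/

section CylMetric

open Filter Topology

variable {m : ℕ}

/-- The conformal factor of the round metric in stereographic coordinates. -/
def stereoFactor (x : EuclideanSpace ℝ (Fin m)) : ℝ := 16 / (‖x‖ ^ 2 + 4) ^ 2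

/-- The gradient of `½ log Φ`, for `Φ` the conformal factor `stereoFactor`. -/
def stereoGrad (x : EuclideanSpace ℝ (Fin m)) (a : Fin m) : ℝ := -2 * x a / (‖x‖ ^ 2 + 4)

theorem stereoFactor_pos (x : EuclideanSpace ℝ (Fin m)) : 0 < stereoFactor x := by
  unfold stereoFactor; positivity

/-- This encodes that the sphere has curvature `1`: with `σ = 2/(‖x‖² + 4)` one has `∂_a ψ_b = ψ_a
ψ_b - σ δ_ab`, and the identity is the hypothesis `hσ` of `cylRiem_eq`. -/
theorem stereoFactor_eq (x : EuclideanSpace ℝ (Fin m)) :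
    2 * (2 / (‖x‖ ^ 2 + 4)) - ∑ s, stereoGrad x s * stereoGrad x s = stereoFactor x := by
  have h : ∑ s, stereoGrad x s * stereoGrad x s = 4 * ‖x‖ ^ 2 / (‖x‖ ^ 2 + 4) ^ 2 := by
    rw [EuclideanSpace.real_norm_sq_eq, Finset.mul_sum, Finset.sum_div]
    exact Finset.sum_congr rfl fun s _ => by
      rw [stereoGrad, EuclideanSpace.real_norm_sq_eq]; field_simp; ring
  have : ‖x‖ ^ 2 + 4 ≠ 0 := by positivity
  rw [h, stereoFactor]
  field_simp
  ring

variable (y : ℝ × EuclideanSpace ℝ (Fin m))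

theorem hasPartials_norm_sq_add :
    HasPartials (fun z : ℝ × EuclideanSpace ℝ (Fin m) => ‖z.2‖ ^ 2 + 4)
      (Sum.elim (fun _ => 0) (fun a => 2 * y.2 a)) y := by
  have h := ((hasStrictFDerivAt_norm_sq y.2).hasFDerivAt.add_const 4).hasPartials
  refine h.congr_deriv ?_
  rintro (⟨⟩ | a)
  · rfl
  · simp [EuclideanSpace.inner_single_right]

theorem hasPartials_inv_norm_sq_add :
    HasPartials (fun z : ℝ × EuclideanSpace ℝ (Fin m) => (‖z.2‖ ^ 2 + 4)⁻¹)
      (Sum.elim (fun _ => 0) (fun a => -(2 * y.2 a) / (‖y.2‖ ^ 2 + 4) ^ 2)) y := by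
  have h := hasPartials_norm_sq_add y
  have hy : ‖y.2‖ ^ 2 + 4 ≠ 0 := by positivity
  have h' := (hasDerivAt_inv hy).comp_hasFDerivAt y h.1.hasFDerivAt
  refine ⟨h'.differentiableAt, fun i => ?_⟩
  have : partialDeriv (cylBasis m) i (fun z => (‖z.2‖ ^ 2 + 4)⁻¹) y
      = -((‖y.2‖ ^ 2 + 4) ^ 2)⁻¹ *
        partialDeriv (cylBasis m) i (fun z => ‖z.2‖ ^ 2 + 4) y := by
    simp only [partialDeriv]
    erw [h'.fderiv]
    rfl
  rw [this, h.2]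
  rcases i with ⟨⟩ | a
  · simp
  · simp only [Sum.elim_inr]; ring

theorem hasPartials_stereoFactor :
    HasPartials (fun z : ℝ × EuclideanSpace ℝ (Fin m) => stereoFactor z.2)
      (Sum.elim (fun _ => 0) (fun a => 2 * stereoFactor y.2 * stereoGrad y.2 a)) y := by
  have h := hasPartials_inv_norm_sq_add y
  have h' := (h.mul h).mul_const 16
  have e : (fun z : ℝ × EuclideanSpace ℝ (Fin m) => stereoFactor z.2)
      = fun z => (‖z.2‖ ^ 2 + 4)⁻¹ * (‖z.2‖ ^ 2 + 4)⁻¹ * 16 := by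
    funext z; rw [stereoFactor]; field_simp
  rw [e]
  refine h'.congr_deriv ?_
  rintro (⟨⟩ | a)
  · simp
  · simp only [Sum.elim_inr, stereoFactor, stereoGrad]; field_simp; ring

theorem hasPartials_stereoGrad (b : Fin m) :
    HasPartials (fun z : ℝ × EuclideanSpace ℝ (Fin m) => stereoGrad z.2 b)
      (Sum.elim (fun _ => 0) (fun a => stereoGrad y.2 a * stereoGrad y.2 b
        - 2 / (‖y.2‖ ^ 2 + 4) * kron a b)) y := by
  have h := hasPartials_inv_norm_sq_add y
  have hb : HasPartials (fun z : ℝ × EuclideanSpace ℝ (Fin m) => z.2 b)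
      (Sum.elim (fun _ => 0) (fun a => kron a b)) y := by
    have := ((EuclideanSpace.proj (𝕜 := ℝ) b).hasFDerivAt (x := y.2)).hasPartials
    refine this.congr_deriv ?_
    rintro (⟨⟩ | a)
    · rfl
    · simp [kron, eq_comm]
  have h' := (hb.mul h).mul_const (-2)
  have e : (fun z : ℝ × EuclideanSpace ℝ (Fin m) => stereoGrad z.2 b)
      = fun z => z.2 b * (‖z.2‖ ^ 2 + 4)⁻¹ * (-2) := by
    funext z; rw [stereoGrad]; ring
  rw [e]
  refine h'.congr_deriv ?_
  rintro (⟨⟩ | a)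
  · simp
  · simp only [Sum.elim_inr, stereoGrad]; field_simp; ring

/-- The components of `A (dt² + Φ dx²)`, where `Φ dx²` is the round metric in stereographic
coordinates. -/
def cylMetric (A : ℝ → ℝ) (y : ℝ × EuclideanSpace ℝ (Fin m)) :
    Matrix (Unit ⊕ Fin m) (Unit ⊕ Fin m) ℝ :=
  Matrix.diagonal (Sum.elim (fun _ => A y.1) (fun _ => A y.1 * stereoFactor y.2))

theorem cylMetric_inv {A : ℝ → ℝ} (hA : A y.1 ≠ 0) : (cylMetric A y)⁻¹ =
    Matrix.diagonal (Sum.elim (fun _ => (A y.1)⁻¹) (fun _ => (A y.1 * stereoFactor y.2)⁻¹)) := by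
  refine Matrix.inv_eq_right_inv ?_
  rw [cylMetric, Matrix.diagonal_mul_diagonal, ← Matrix.diagonal_one]
  congr 1
  funext i
  have := (stereoFactor_pos y.2).ne'
  rcases i with ⟨⟩ | a
  · simp [hA]
  · simp only [Sum.elim_inr]; field_simp

theorem hasPartials_cylMetric {A : ℝ → ℝ} {A' : ℝ} (hA : HasDerivAt A A' y.1)
    (i j : Unit ⊕ Fin m) :
    HasPartials (fun z => cylMetric A z i j)
      (fun e => Matrix.diagonal (Sum.elim (fun _ => Sum.elim (fun _ => A') (fun _ => 0) e)
        (fun _ => Sum.elim (fun _ => A' * stereoFactor y.2)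
          (fun a => A y.1 * (2 * stereoFactor y.2 * stereoGrad y.2 a)) e)) i j) y := by
  by_cases hij : i = j
  · subst hij
    simp only [cylMetric, Matrix.diagonal_apply_eq]
    rcases i with ⟨⟩ | b
    · exact hA.hasPartials
    · refine (hA.hasPartials.mul (hasPartials_stereoFactor y)).congr_deriv ?_
      rintro (⟨⟩ | a) <;> simp
  · simp only [cylMetric, Matrix.diagonal_apply_ne _ hij]
    exact hasPartials_const 0

theorem christoffel_cylMetric {A : ℝ → ℝ} {p : ℝ} (h0 : A y.1 ≠ 0)
    (hA : HasDerivAt A (2 * A y.1 * p) y.1) (k i j : Unit ⊕ Fin m) :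
    christoffel (cylBasis m) (cylMetric A) k i j y
      = cylGamma (stereoFactor y.2 * p) p (stereoGrad y.2) k i j := by
  have hΦ := (stereoFactor_pos y.2).ne'
  have h1 : ∀ i j k, partialDeriv (cylBasis m) i (fun z => cylMetric A z j k) y = _ := fun i j k =>
    (hasPartials_cylMetric y hA j k).2 i
  simp only [christoffel, h1, cylMetric_inv y h0]
  -- The inverse metric is diagonal, so only `l = k` contributes.
  rw [Finset.sum_eq_single k (fun l _ hl => by rw [Matrix.diagonal_apply_ne _ hl.symm, zero_mul])
    (fun h => absurd (Finset.mem_univ k) h)]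
  rcases k with ⟨⟩ | k <;> rcases i with ⟨⟩ | i <;> rcases j with ⟨⟩ | j <;>
    simp [cylGamma, Matrix.diagonal_apply, kron]
  · field_simp
  · split_ifs <;> field_simp
  · simp only [@eq_comm _ k]
    split_ifs <;> field_simp
  · simp only [@eq_comm _ k]
    split_ifs <;> field_simp
  · simp only [@eq_comm _ k]
    split_ifs <;> field_simp <;> ring

variable {A p q q' : ℝ → ℝ}

theorem riemannCurv_cylMetric (h0 : ∀ t, A t ≠ 0) (hA : ∀ t, HasDerivAt A (2 * A t * p t) t)
    (hp : ∀ t, HasDerivAt p (-q t) t) (l i j k : Unit ⊕ Fin m) :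
    riemannCurv (cylBasis m) (cylMetric A) l i j k y
      = cylRiem (q y.1 * stereoFactor y.2) (q y.1) ((1 - p y.1 ^ 2) * stereoFactor y.2) l i j k := by
  have h1 : ∀ k i j, christoffel (cylBasis m) (cylMetric A) k i j = fun z =>
      cylGamma (stereoFactor z.2 * p z.1) (p z.1) (stereoGrad z.2) k i j := fun k i j =>
    funext fun z => christoffel_cylMetric z (h0 _) (hA _) k i j
  have hp1 := (hp y.1).hasPartials
  have h2 : ∀ i l j k, partialDeriv (cylBasis m) i (fun z =>
      cylGamma (stereoFactor z.2 * p z.1) (p z.1) (stereoGrad z.2) l j k) y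
      = cylGammaDeriv (stereoFactor y.2) (p y.1) (-q y.1) (2 / (‖y.2‖ ^ 2 + 4))
        (stereoGrad y.2) i l j k := by
    intro i l j k
    rw [(HasPartials.cylGamma (ψ := fun z b => stereoGrad z.2 b)
      (Dψ := fun e b => Sum.elim (fun _ => 0) (fun a => stereoGrad y.2 a * stereoGrad y.2 b
        - 2 / (‖y.2‖ ^ 2 + 4) * kron a b) e)
      ((hasPartials_stereoFactor y).mul hp1) hp1 (hasPartials_stereoGrad y) l j k).2 i]
    rcases i with ⟨⟩ | i
    · simp [cylGammaDeriv, Pi.zero_def]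
    · simp [cylGammaDeriv]
  have h3 := cylRiem_eq (stereoFactor y.2) (p y.1) (-q y.1) (2 / (‖y.2‖ ^ 2 + 4))
        (stereoGrad y.2) (stereoFactor_eq y.2) l i j k
  rw [neg_neg] at h3
  rw [← h3]
  simp only [riemannCurv, h1, h2]

theorem divRiemann_cylMetric (h0 : ∀ t, A t ≠ 0) (hA : ∀ t, HasDerivAt A (2 * A t * p t) t)
    (hp : ∀ t, HasDerivAt p (-q t) t) (hq : ∀ t, HasDerivAt q (q' t) t)
    (hq' : ∀ t, q' t = -(m - 3) * p t * q t + (m - 1) * p t * (1 - p t ^ 2))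
    (i j k : Unit ⊕ Fin m) :
    divRiemann (cylBasis m) (cylMetric A) i j k y = 0 := by
  have h1 : ∀ k i j, christoffel (cylBasis m) (cylMetric A) k i j = fun z =>
      cylGamma (stereoFactor z.2 * p z.1) (p z.1) (stereoGrad z.2) k i j := fun k i j =>
    funext fun z => christoffel_cylMetric z (h0 _) (hA _) k i j
  have h2 : ∀ l i j k, riemannCurv (cylBasis m) (cylMetric A) l i j k = fun z =>
      cylRiem (q z.1 * stereoFactor z.2) (q z.1) ((1 - p z.1 ^ 2) * stereoFactor z.2) l i j k :=
    fun l i j k => funext fun z => riemannCurv_cylMetric z h0 hA hp l i j k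
  have hq1 := (hq y.1).hasPartials
  -- Here `K' = -2 p p' = 2 p q`.
  have hK : HasDerivAt (fun t => 1 - p t ^ 2) (2 * p y.1 * q y.1) y.1 :=
    (((hp y.1).fun_pow 2).const_sub 1).congr_deriv (by push_cast; ring)
  have h3 : ∀ i l j k s, partialDeriv (cylBasis m) i (fun z =>
      cylRiem (q z.1 * stereoFactor z.2) (q z.1) ((1 - p z.1 ^ 2) * stereoFactor z.2) l j k s) y
      = cylRiemDeriv (stereoFactor y.2) (q y.1) (q' y.1) (1 - p y.1 ^ 2) (2 * p y.1 * q y.1)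
        (stereoGrad y.2) i l j k s := by
    intro i l j k s
    rw [(HasPartials.cylRiem (hq1.mul (hasPartials_stereoFactor y)) hq1
      (hK.hasPartials.mul (hasPartials_stereoFactor y)) l j k s).2 i]
    rcases i with ⟨⟩ | i <;> simp [cylRiemDeriv]
  rw [← sum_cylRiemCov (stereoFactor y.2) (p y.1) (q y.1) (q' y.1) (1 - p y.1 ^ 2)
    (2 * p y.1 * q y.1) (stereoGrad y.2) (hq' y.1) i j k]
  simp only [divRiemann, covDerivRiemann, cylRiemCov, h1, h2, h3]

theorem ricciCurv_cylMetric (h0 : ∀ t, A t ≠ 0) (hA : ∀ t, HasDerivAt A (2 * A t * p t) t)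
    (hp : ∀ t, HasDerivAt p (-q t) t) (j k : Unit ⊕ Fin m) :
    ricciCurv (cylBasis m) (cylMetric A) j k y
      = cylRic (m * q y.1) ((q y.1 + (m - 1) * (1 - p y.1 ^ 2)) * stereoFactor y.2) j k := by
  simp only [ricciCurv, riemannCurv_cylMetric y h0 hA hp, sum_cylRiem]
  congr 1
  ring

/-- The mixed Ricci components vanish identically, so no derivative term appears: the value comes
from the Christoffel symbols acting on the difference of the two Ricci eigenvalues, a multiple of `q
- K`. -/
theorem covDerivRicci_cylMetric_mixed (h0 : ∀ t, A t ≠ 0)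
    (hA : ∀ t, HasDerivAt A (2 * A t * p t) t) (hp : ∀ t, HasDerivAt p (-q t) t) (a : Fin m) :
    covDerivRicci (cylBasis m) (cylMetric A) (.inr a) (.inl ()) (.inr a) y
      = (m - 1) * p y.1 * (q y.1 - (1 - p y.1 ^ 2)) * stereoFactor y.2 := by
  have h1 : ∀ j k, ricciCurv (cylBasis m) (cylMetric A) j k = fun z =>
      cylRic (m * q z.1) ((q z.1 + (m - 1) * (1 - p z.1 ^ 2)) * stereoFactor z.2) j k :=
    fun j k => funext fun z => ricciCurv_cylMetric z h0 hA hp j k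
  simp only [covDerivRicci, christoffel_cylMetric y (h0 _) (hA _), h1, sum_cylGamma_cylRic]
  simp only [cylRic, partialDeriv, fderiv_fun_const, kron_self, Pi.zero_apply, zero_apply]
  ring

theorem covDerivRicci_cylMetric_const {c : ℝ} (hc : c ≠ 0) (e j k : Unit ⊕ Fin m) :
    covDerivRicci (cylBasis m) (cylMetric fun _ => c) e j k y = 0 := by
  have hA : ∀ t : ℝ, HasDerivAt (fun _ : ℝ => c) (2 * c * 0) t := fun t => by
    simpa using hasDerivAt_const t c
  have hp : ∀ t : ℝ, HasDerivAt (fun _ : ℝ => (0 : ℝ)) (-0) t := fun t => by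
    simpa using hasDerivAt_const t (0 : ℝ)
  have h1 : ∀ j k, ricciCurv (cylBasis m) (cylMetric fun _ => c) j k = fun z =>
      cylRic 0 (stereoFactor z.2 * (m - 1)) j k :=
    fun j k => funext fun z => by
      rw [ricciCurv_cylMetric (p := fun _ => 0) (q := fun _ => 0) z (fun _ => hc) hA hp j k]
      congr 1 <;> ring
  have h2 := (((hasPartials_const 0).cylRic ((hasPartials_stereoFactor y).mul_const ((m : ℝ) - 1))
    j k).2 e)
  rw [← cylRic_parallel_of_product (stereoFactor y.2) (m - 1) (stereoGrad y.2) e j k]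
  simp only [covDerivRicci, christoffel_cylMetric (p := 0) y hc (hA _), h1, h2,
    mul_comm (stereoFactor y.2), zero_mul]
  congr 1
  rcases e with ⟨⟩ | e
  · rcases j with ⟨⟩ | j <;> rcases k with ⟨⟩ | k <;> simp [cylRic]
  · simp only [Sum.elim_inr, Pi.zero_apply]
    congr 1
    ring

end CylMetric

/-! ### Smooth maps between circles and their differentials. -/

section CircleMaps

open Filter Topology

variable {T : ℝ} [Fact (0 < T)]

theorem contMDiff_coe_addCircle {k : ℕ∞ω} :
    ContMDiff 𝓘(ℝ, ℝ) 𝓘(ℝ, ℝ) k ((↑) : ℝ → AddCircle T) := by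
  intro t
  have hT : 0 < T := Fact.out
  have he : (AddCircle.openPartialHomeomorphCoe T (t - T / 2)).symm ∈
      IsManifold.maximalAtlas 𝓘(ℝ, ℝ) ω (AddCircle T) :=
    IsManifold.subset_maximalAtlas ⟨_, rfl⟩
  exact (contMDiffAt_symm_of_mem_maximalAtlas he
    (show t ∈ Ioo (t - T / 2) (t - T / 2 + T) from ⟨by linarith, by linarith⟩)).of_le le_top

/-- Near any point the map factors as its lift to the line composed with a chart, since a chart is a
section of the quotient map. -/
theorem contMDiff_of_comp_coe_addCircle {k : ℕ∞ω} {E H M : Type*} [NormedAddCommGroup E]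
    [NormedSpace ℝ E] [TopologicalSpace H] {I : ModelWithCorners ℝ E H} [TopologicalSpace M]
    [ChartedSpace H M] {f : AddCircle T → M}
    (hf : ContMDiff 𝓘(ℝ, ℝ) I k fun t : ℝ => f t) : ContMDiff 𝓘(ℝ, ℝ) I k f := by
  intro x
  obtain ⟨t, rfl⟩ := QuotientAddGroup.mk_surjective x
  have hT : 0 < T := Fact.out
  -- The interval is centred at `t`, so that `t` lies in its interior.
  set e := AddCircle.openPartialHomeomorphCoe T (t - T / 2) with he
  have he' : e.symm ∈ IsManifold.maximalAtlas 𝓘(ℝ, ℝ) ω (AddCircle T) :=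
    IsManifold.subset_maximalAtlas ⟨_, rfl⟩
  have h := (contMDiffAt_of_mem_maximalAtlas he' (e.map_source
    (show t ∈ Ioo (t - T / 2) (t - T / 2 + T) from ⟨by linarith, by linarith⟩))).of_le
      (le_top (a := k))
  have hc := (hf _).comp _ h
  have hfe : (fun t : ℝ => f t) ∘ e.symm = f :=
    funext fun x => congrArg f (AddCircle.coe_equivIco (p := T) (a := t - T / 2) (y := x))
  rwa [hfe] at hc

/-- The difference between the chosen representative and `s` is an integer multiple of `T` and
continuous near `t`, hence locally constant. -/
theorem equivIco_coe_eventuallyEq {a t : ℝ}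
    (ht : (t : AddCircle T) ∈ (AddCircle.openPartialHomeomorphCoe T a).target) :
    ∃ c : ℝ, (fun s : ℝ => (AddCircle.equivIco T a (s : AddCircle T) : ℝ)) =ᶠ[𝓝 t]
      fun s => s + c := by
  set e := AddCircle.openPartialHomeomorphCoe T a
  have hT : 0 < T := Fact.out
  have hdiff : ∀ z : ℝ, ∃ k : ℤ, e.symm (z : AddCircle T) - z = k * T := by
    intro z
    have h : ((e.symm (z : AddCircle T) : ℝ) : AddCircle T) = (z : AddCircle T) :=
      AddCircle.coe_equivIco (p := T) (a := a) (y := (z : AddCircle T))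
    rw [← sub_eq_zero, ← AddCircle.coe_sub, AddCircle.coe_eq_zero_iff] at h
    obtain ⟨k, hk⟩ := h
    exact ⟨k, by rw [← hk]; simp⟩
  have hcont : ContinuousAt (fun z : ℝ => e.symm (z : AddCircle T) - z) t :=
    ((e.continuousAt_symm ht).comp (f := ((↑) : ℝ → AddCircle T))
      (AddCircle.continuous_mk' T).continuousAt).sub continuousAt_id
  refine ⟨e.symm (t : AddCircle T) - t, ?_⟩
  filter_upwards [Metric.continuousAt_iff'.1 hcont T hT] with z hz
  obtain ⟨k, hk⟩ := hdiff z
  obtain ⟨l, hl⟩ := hdiff t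
  rw [Real.dist_eq, hk, hl, ← sub_mul, abs_mul, abs_of_pos hT] at hz
  have h1 : |(k : ℝ) - l| < 1 := by nlinarith
  have h2 : k = l := by
    rw [← sub_eq_zero, ← Int.abs_lt_one_iff]
    exact_mod_cast h1
  rw [hl, ← h2, ← hk]
  exact (add_sub_cancel _ _).symm

/-- Tangent spaces are read in the preferred charts, where the quotient map is locally a
translation. -/
theorem hasMFDerivAt_coe_addCircle (t : ℝ) :
    HasMFDerivAt 𝓘(ℝ, ℝ) 𝓘(ℝ, ℝ) ((↑) : ℝ → AddCircle T) t (ContinuousLinearMap.id ℝ ℝ) := by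
  refine ⟨(AddCircle.continuous_mk' T).continuousAt, ?_⟩
  obtain ⟨c, hc⟩ := equivIco_coe_eventuallyEq (T := T) (t := t)
    (mem_chart_source ℝ (t : AddCircle T))
  have h : HasFDerivAt (fun s : ℝ => s + c) (ContinuousLinearMap.id ℝ ℝ) t :=
    (hasFDerivAt_id t).add_const c
  exact (h.congr_of_eventuallyEq hc).hasFDerivWithinAt

variable {S : ℝ} [Fact (0 < S)] {σ τ : ℝ → ℝ}

/-- The map of circles induced by a map `σ` of the line with `σ (t + S) = σ t + T`. -/
def addCircleMap (hσ : ∀ t, σ (t + S) = σ t + T) : AddCircle S → AddCircle T :=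
  Function.Periodic.lift (f := fun t => (σ t : AddCircle T)) (c := S) fun t => by
    simp [hσ t]

theorem contMDiff_addCircleMap (hσ : ∀ t, σ (t + S) = σ t + T) {k : ℕ∞ω} (h : ContDiff ℝ k σ) :
    ContMDiff 𝓘(ℝ, ℝ) 𝓘(ℝ, ℝ) k (addCircleMap hσ) :=
  contMDiff_of_comp_coe_addCircle (contMDiff_coe_addCircle.comp h.contMDiff)

theorem mfderiv_addCircleMap (hσ : ∀ t, σ (t + S) = σ t + T) (h : ContDiff ℝ ∞ σ) {t σ' : ℝ}
    (hd : HasDerivAt σ σ' t) (v : ℝ) :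
    (mfderiv 𝓘(ℝ, ℝ) 𝓘(ℝ, ℝ) (addCircleMap hσ) (t : AddCircle S) : ℝ → ℝ) v = σ' * v := by
  -- Chain rule on both sides of the commuting square of the lift `σ` and the quotient maps, whose
  -- differentials are the identity.
  have h1 := ((contMDiff_addCircleMap hσ h).mdifferentiable (by simp) (t : AddCircle S)).hasMFDerivAt.comp
    t (hasMFDerivAt_coe_addCircle t)
  have h2 := (hasMFDerivAt_coe_addCircle (T := T) (σ t)).comp t hd.hasFDerivAt.hasMFDerivAt
  have h3 := congrArg (fun L : ℝ →L[ℝ] ℝ => L v) (hasMFDerivAt_unique h1 h2)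
  refine Eq.trans h3 ?_
  change v * σ' = _
  exact mul_comm _ _

/-- The diffeomorphism of circles induced by a diffeomorphism `σ` of the line with
`σ (t + S) = σ t + T`. -/
def addCircleDiffeo (hσ : ∀ t, σ (t + S) = σ t + T) (hτ : ∀ t, τ (t + T) = τ t + S)
    (h : ContDiff ℝ ∞ σ) (h' : ContDiff ℝ ∞ τ) (hστ : ∀ t, τ (σ t) = t) (hτσ : ∀ t, σ (τ t) = t) :
    AddCircle S ≃ₘ⟮𝓘(ℝ, ℝ), 𝓘(ℝ, ℝ)⟯ AddCircle T where
  toFun := addCircleMap hσ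
  invFun := addCircleMap hτ
  left_inv x := by
    obtain ⟨t, rfl⟩ := QuotientAddGroup.mk_surjective x
    change ((τ (σ t) : ℝ) : AddCircle S) = _
    rw [hστ]
  right_inv x := by
    obtain ⟨t, rfl⟩ := QuotientAddGroup.mk_surjective x
    change ((σ (τ t) : ℝ) : AddCircle T) = _
    rw [hτσ]
  contMDiff_toFun := contMDiff_addCircleMap hσ h
  contMDiff_invFun := contMDiff_addCircleMap hτ h'

end CircleMaps

/-! ### The round metric in stereographic charts. -/

section SphereCharts

/-- The differential at `w` combines the mutually orthogonal parts along `L` and `v`. In the inner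
product, the `⟪x, w⟫ ⟪x, z⟫` terms total `64(‖x‖² + 4)/(‖x‖² + 4)⁴ - 64/(‖x‖² + 4)³ = 0`, so only
the conformal part is left. -/
theorem inner_fderiv_stereoInv {E F : Type*} [NormedAddCommGroup E] [InnerProductSpace ℝ E]
    [NormedAddCommGroup F] [InnerProductSpace ℝ F] (L : E →ₗᵢ[ℝ] F) {v : F} (hv : ‖v‖ = 1)
    (hL : ∀ x, ⟪L x, v⟫ = 0) (x w z : E) :
    ⟪fderiv ℝ (fun x => stereoInvFunAux v (L x)) x w, fderiv ℝ (fun x => stereoInvFunAux v (L x)) x z⟫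
      = 16 / (‖x‖ ^ 2 + 4) ^ 2 * ⟪w, z⟫ := by
  have hs : ‖x‖ ^ 2 + 4 ≠ 0 := by positivity
  have h1 : HasFDerivAt (fun x : E => ‖x‖ ^ 2) (2 • innerSL ℝ x) x :=
    (hasStrictFDerivAt_norm_sq x).hasFDerivAt
  have h2 := (hasDerivAt_inv hs).comp_hasFDerivAt x (h1.add_const 4)
  have h3 : HasFDerivAt (fun x => L x) L.toContinuousLinearMap x :=
    L.toContinuousLinearMap.hasFDerivAt
  have h4 := h2.fun_smul ((h3.fun_const_smul (4 : ℝ)).fun_add ((h1.sub_const 4).smul_const v))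
  have h5 : (fun x => stereoInvFunAux v (L x)) = fun x =>
      ((fun y => y⁻¹) ∘ fun x => ‖x‖ ^ 2 + 4) x • ((4 : ℝ) • L x + (‖x‖ ^ 2 - 4) • v) := by
    funext x
    simp [stereoInvFunAux_apply, L.norm_map]
  have h6 : ∀ w, fderiv ℝ (fun x => stereoInvFunAux v (L x)) x w
      = (-8 * ⟪x, w⟫ / (‖x‖ ^ 2 + 4) ^ 2) • L x + (4 / (‖x‖ ^ 2 + 4)) • L w
        + (16 * ⟪x, w⟫ / (‖x‖ ^ 2 + 4) ^ 2) • v := by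
    intro w
    rw [h5, h4.fderiv]
    simp only [add_apply, smul_apply, ContinuousLinearMap.smulRight_apply, innerSL_apply_apply,
      LinearIsometry.coe_toContinuousLinearMap, Function.comp_apply, smul_eq_mul, nsmul_eq_mul,
      Nat.cast_ofNat]
    match_scalars
    · field_simp
    · field_simp
      ring
    · field_simp
      ring
  have hvL : ∀ x, ⟪v, L x⟫ = 0 := fun x => by rw [real_inner_comm]; exact hL x
  rw [h6, h6]
  simp only [inner_add_left, inner_add_right, inner_smul_left, inner_smul_right, hL, hvL,
    L.inner_map_map, real_inner_self_eq_norm_sq, hv, conj_trivial, real_inner_comm x]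
  field_simp
  ring

variable {m : ℕ}

theorem inner_mvfderiv_chart {e : OpenPartialHomeomorph (UnitSphere m) (EuclideanSpace ℝ (Fin m))}
    (he : e ∈ atlas (EuclideanSpace ℝ (Fin m)) (UnitSphere m)) (x w z : EuclideanSpace ℝ (Fin m)) :
    MDifferentiableAt (𝓡 m) (𝓡 m) e.symm x ∧
    roundMetric (e.symm x) (mfderiv (𝓡 m) (𝓡 m) e.symm x w) (mfderiv (𝓡 m) (𝓡 m) e.symm x z)
      = stereoFactor x * ⟪w, z⟫ := by
  have := Fact.mk (@finrank_euclideanSpace_fin ℝ _ (m + 1))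
  have hM : e ∈ IsManifold.maximalAtlas (𝓡 m) ω (UnitSphere m) :=
    IsManifold.subset_maximalAtlas he
  obtain ⟨v, rfl⟩ := he
  have hd : MDifferentiableAt (𝓡 m) (𝓡 m) (stereographic' m v).symm x :=
    (contMDiffAt_symm_of_mem_maximalAtlas hM (by simp)).mdifferentiableAt (by simp)
  refine ⟨hd, ?_⟩
  have hc := (contMDiff_coe_sphere (m := 1) (n := m)
    (E := EuclideanSpace ℝ (Fin (m + 1)))).mdifferentiable one_ne_zero ((stereographic' m v).symm x)
  let U := (OrthonormalBasis.fromOrthogonalSpanSingleton (𝕜 := ℝ) m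
    (ne_zero_of_mem_unit_sphere v)).repr
  let L : EuclideanSpace ℝ (Fin m) →ₗᵢ[ℝ] EuclideanSpace ℝ (Fin (m + 1)) :=
    (ℝ ∙ (v : EuclideanSpace ℝ (Fin (m + 1))))ᗮ.subtypeₗᵢ.comp U.symm.toLinearIsometry
  have hL : ∀ x, ⟪L x, (v : EuclideanSpace ℝ (Fin (m + 1)))⟫ = 0 := fun x =>
    Submodule.mem_orthogonal_singleton_iff_inner_left.1 (U.symm x).2
  have hcomp := mfderiv_comp x hc hd
  -- The inverse chart, seen in the ambient space, is the explicit inverse stereographic formula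
  -- after identifying `v^⊥` with the model space.
  have hf : ((↑) : UnitSphere m → EuclideanSpace ℝ (Fin (m + 1))) ∘ (stereographic' m v).symm
      = fun x => stereoInvFunAux (v : EuclideanSpace ℝ (Fin (m + 1))) (L x) := rfl
  have key : ∀ w : EuclideanSpace ℝ (Fin m),
      mvfderiv (𝓡 m) ((↑) : UnitSphere m → EuclideanSpace ℝ (Fin (m + 1)))
        ((stereographic' m v).symm x) (mfderiv (𝓡 m) (𝓡 m) (stereographic' m v).symm x w)
      = fderiv ℝ (fun x => stereoInvFunAux (v : EuclideanSpace ℝ (Fin (m + 1))) (L x)) x w := by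
    intro w
    rw [← mfderiv_eq_fderiv, ← hf, hcomp]
    rfl
  unfold roundMetric
  rw [key, key]
  exact inner_fderiv_stereoInv L (norm_eq_of_mem_sphere v) hL x w z

end SphereCharts

/-! ### The metric of the cylinder in product charts. -/

section CylinderCharts

variable {m : ℕ} {T : ℝ} [Fact (0 < T)]

theorem rotMetric_apply (A B : AddCircle T → ℝ) (p : Cylinder m T)
    (v w : TangentSpace (cylModel m) p) :
    rotMetric A B p v w = A p.1 * ((show ℝ × EuclideanSpace ℝ (Fin m) from v).1
        * (show ℝ × EuclideanSpace ℝ (Fin m) from w).1)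
      + B p.1 * roundMetric p.2 (show ℝ × EuclideanSpace ℝ (Fin m) from v).2
        (show ℝ × EuclideanSpace ℝ (Fin m) from w).2 := by
  unfold rotMetric
  rw [mfderiv_fst, mfderiv_snd]
  rfl

/-- The equality holds on the whole model space, not only on the chart image: the inverse circle
chart is the quotient map on all of `ℝ`, and inverse stereographic projection is defined everywhere.
Derivatives of the components therefore need no localization. -/
theorem metricInChart_rotMetric (A : AddCircle T → ℝ)
    {e : OpenPartialHomeomorph (Cylinder m T) (ModelProd ℝ (EuclideanSpace ℝ (Fin m)))}
    (he : e ∈ atlas (ModelProd ℝ (EuclideanSpace ℝ (Fin m))) (Cylinder m T)) :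
    metricInChart (cylBasis m) (rotMetric A A) e = cylMetric fun t => A t := by
  obtain ⟨_, ⟨a, rfl⟩, e₂, he₂, rfl⟩ := he
  funext y
  have hsymm : ((((AddCircle.openPartialHomeomorphCoe T a).symm.prod e₂).extend
      (cylModel m)).symm : ℝ × EuclideanSpace ℝ (Fin m) → Cylinder m T)
      = fun z => ((z.1 : AddCircle T), e₂.symm z.2) := rfl
  have h1 := (hasMFDerivAt_coe_addCircle (T := T) y.1).comp y
    (hasFDerivAt_fst (𝕜 := ℝ) (p := y)).hasMFDerivAt
  have h2 := (inner_mvfderiv_chart he₂ y.2 0 0).1.hasMFDerivAt.comp y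
    (hasFDerivAt_snd (𝕜 := ℝ) (p := y)).hasMFDerivAt
  have h3 := (h1.prodMk h2).mfderiv
  ext i j
  rw [metricInChart, Matrix.of_apply, hsymm]
  erw [h3]
  rw [rotMetric_apply]
  have key : ∀ v w : ℝ × EuclideanSpace ℝ (Fin m),
      A (y.1 : AddCircle T) * (v.1 * w.1) + A (y.1 : AddCircle T) *
        roundMetric (e₂.symm y.2) (mfderiv (𝓡 m) (𝓡 m) e₂.symm y.2 v.2)
          (mfderiv (𝓡 m) (𝓡 m) e₂.symm y.2 w.2)
      = A (y.1 : AddCircle T) * (v.1 * w.1)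
        + A (y.1 : AddCircle T) * (stereoFactor y.2 * ⟪v.2, w.2⟫) := fun v w => by
    rw [(inner_mvfderiv_chart he₂ y.2 v.2 w.2).2]
  refine (key (cylBasis m i) (cylBasis m j)).trans ?_
  rcases i with ⟨⟩ | i <;> rcases j with ⟨⟩ | j <;>
    simp [cylBasis_inl, cylBasis_inr, cylMetric, Matrix.diagonal_apply, eq_comm,
      EuclideanSpace.inner_single_left]

end CylinderCharts

/-! ### The equation for `u`: logarithmic slope, first integral and rigidity. -/

theorem Function.Periodic.deriv {f : ℝ → ℝ} {c : ℝ} (hf : Function.Periodic f c) :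
    Function.Periodic (deriv f) c := fun t => by
  rw [← deriv_comp_add_const, funext hf]

namespace IsPseudoCylindricFactor

variable {n : ℕ} {T : ℝ} {u : ℝ → ℝ}

theorem hasDerivAt (hu : IsPseudoCylindricFactor n T u) (t : ℝ) : HasDerivAt u (deriv u t) t :=
  (hu.smooth.differentiable (by simp) t).hasDerivAt

theorem contDiff_deriv (hu : IsPseudoCylindricFactor n T u) : ContDiff ℝ ∞ (deriv u) :=
  ((contDiff_infty_iff_deriv ).1 hu.smooth).2

theorem hasDerivAt_deriv (hu : IsPseudoCylindricFactor n T u) (t : ℝ) :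
    HasDerivAt (deriv u) (deriv (deriv u) t) t :=
  (hu.contDiff_deriv.differentiable (by simp) t).hasDerivAt

/-- The factor `u^{4/(n-2)}` of the metric. -/
def metricFactor (n : ℕ) (u : ℝ → ℝ) (t : ℝ) : ℝ := u t ^ (4 / ((n : ℝ) - 2))

/-- Half the logarithmic derivative of `metricFactor n u`. -/
def logSlope (n : ℕ) (u : ℝ → ℝ) (t : ℝ) : ℝ := 2 / ((n : ℝ) - 2) * (deriv u t / u t)

theorem metricFactor_pos (hu : IsPseudoCylindricFactor n T u) (t : ℝ) : 0 < metricFactor n u t :=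
  Real.rpow_pos_of_pos (hu.pos t) _

theorem hasDerivAt_rpow (hu : IsPseudoCylindricFactor n T u) (r t : ℝ) :
    HasDerivAt (fun t => u t ^ r) (r * (deriv u t / u t) * u t ^ r) t := by
  convert (hu.hasDerivAt t).rpow_const (p := r) (Or.inl (hu.pos t).ne') using 1
  rw [Real.rpow_sub_one (hu.pos t).ne']
  ring

theorem hasDerivAt_metricFactor (hu : IsPseudoCylindricFactor n T u) (t : ℝ) :
    HasDerivAt (metricFactor n u) (2 * metricFactor n u t * logSlope n u t) t :=
  (hu.hasDerivAt_rpow _ t).congr_deriv (by simp only [logSlope, metricFactor]; ring)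

/-- This is the equation for `u` as a Riccati equation for `p`, namely `q = (n/2) A - ((n-2)/2) (1 -
p²)`: geometrically, constant scalar curvature. -/
theorem hasDerivAt_logSlope (hn : 3 ≤ n) (hu : IsPseudoCylindricFactor n T u) (t : ℝ) :
    HasDerivAt (logSlope n u) (-((n : ℝ) / 2 * metricFactor n u t
      - ((n : ℝ) - 2) / 2 * (1 - logSlope n u t ^ 2))) t := by
  have hn' : (0 : ℝ) < n - 2 := by
    have : (3 : ℝ) ≤ n := by exact_mod_cast hn
    linarith
  have h := ((hu.hasDerivAt_deriv t).fun_div (hu.hasDerivAt t) (hu.pos t).ne').const_mul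
    (2 / ((n : ℝ) - 2))
  refine h.congr_deriv ?_
  have h1 : u t ^ (((n : ℝ) + 2) / ((n : ℝ) - 2)) = u t * metricFactor n u t := by
    rw [metricFactor, ← Real.rpow_one_add' (hu.pos t).le (by positivity)]
    congr 1
    field_simp
    ring
  have h2 := hu.ode t
  rw [h1] at h2
  have h3 : deriv (deriv u) t = ((n : ℝ) - 2) ^ 2 / 4 * u t
      - (n : ℝ) * ((n : ℝ) - 2) / 4 * (u t * metricFactor n u t) := by linarith
  have := (hu.pos t).ne'
  rw [h3, logSlope]
  field_simp
  ring

theorem periodic_logSlope (hu : IsPseudoCylindricFactor n T u) :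
    Function.Periodic (logSlope n u) T := fun t => by
  simp only [logSlope, hu.periodic t, hu.periodic.deriv t]

/-- A first integral of the equation. -/
theorem firstIntegral (hn : 3 ≤ n) (hu : IsPseudoCylindricFactor n T u) (s t : ℝ) :
    (1 - logSlope n u s ^ 2 - metricFactor n u s) * u s ^ 2
      = (1 - logSlope n u t ^ 2 - metricFactor n u t) * u t ^ 2 := by
  have hn' : (0 : ℝ) < n - 2 := by
    have : (3 : ℝ) ≤ n := by exact_mod_cast hn
    linarith
  have h : ∀ t, HasDerivAt (fun t => (1 - logSlope n u t ^ 2 - metricFactor n u t) * u t ^ 2) 0 t := by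
    intro t
    refine (((((hu.hasDerivAt_logSlope hn t).fun_pow 2).const_sub 1).fun_sub
      (hu.hasDerivAt_metricFactor t)).fun_mul ((hu.hasDerivAt t).fun_pow 2)).congr_deriv ?_
    -- With `u' = ((n-2)/2) p u`, the derivative is `p u²` times `2q - 2A + (n-2)(1 - p² - A)`,
    -- which the formula for `q` makes zero.
    have h1 : deriv u t = (n - 2) / 2 * logSlope n u t * u t := by
      have := (hu.pos t).ne'
      rw [logSlope]
      field_simp
    rw [h1]
    push_cast
    ring
  exact is_const_of_deriv_eq_zero (fun t => (h t).differentiableAt) (fun t => (h t).deriv) s t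

/-- A periodic solution for which `logSlope` vanishes or the curvature is constant at each point
has `logSlope` identically zero. -/
theorem logSlope_eq_zero (hn : 3 ≤ n) (hT : 0 < T) (hu : IsPseudoCylindricFactor n T u)
    (h : ∀ t, logSlope n u t = 0 ∨ (n : ℝ) / 2 * metricFactor n u t
      - ((n : ℝ) - 2) / 2 * (1 - logSlope n u t ^ 2) = 1 - logSlope n u t ^ 2) (t : ℝ) :
    logSlope n u t = 0 := by
  by_contra ht
  have hn' : (0 : ℝ) < n := by
    have : (3 : ℝ) ≤ n := by exact_mod_cast hn
    linarith
  -- Where `p ≠ 0` the alternative is `q = K`, equivalent to `K = A`; the first integral then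
  -- vanishes and spreads `K = A` to the whole line.
  have h1 : 1 - logSlope n u t ^ 2 - metricFactor n u t = 0 := by
    have := (h t).resolve_left ht
    have h2 : (n : ℝ) * (1 - logSlope n u t ^ 2 - metricFactor n u t) = 0 := by linarith
    exact (mul_eq_zero.1 h2).resolve_left hn'.ne'
  have h2 : ∀ s, 1 - logSlope n u s ^ 2 = metricFactor n u s := fun s => by
    have := hu.firstIntegral hn s t
    rw [h1, zero_mul] at this
    exact sub_eq_zero.1 ((mul_eq_zero.1 this).resolve_right (pow_pos (hu.pos s) 2).ne')
  have h3 : StrictAnti (logSlope n u) := by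
    refine strictAnti_of_deriv_neg fun s => ?_
    rw [(hu.hasDerivAt_logSlope hn s).deriv, h2 s]
    have := hu.metricFactor_pos s
    linarith
  have h4 := h3 (show t < t + T by linarith)
  rw [hu.periodic_logSlope t] at h4
  exact lt_irrefl _ h4

end IsPseudoCylindricFactor

/-! ### Harmonic curvature, and the characterization of parallel Ricci tensor. -/

section Curvature

variable {n : ℕ} {T : ℝ} [Fact (0 < T)] {u : ℝ → ℝ}

open IsPseudoCylindricFactor

theorem isCylindrical_rotMetric_iff {m : ℕ} (A : AddCircle T → ℝ) :
    IsCylindrical (rotMetric (m := m) A A) ↔ ∃ a, 0 < a ∧ ∀ x, A x = a := by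
  constructor
  · rintro ⟨a, ha, h⟩
    refine ⟨a, ha, fun x => ?_⟩
    let ξ : UnitSphere m := ⟨EuclideanSpace.single 0 1, by simp⟩
    -- A vector with no sphere component compares the `dt²` coefficients alone.
    let v : TangentSpace (cylModel m) ((x, ξ) : Cylinder m T) :=
      ((1, 0) : ℝ × EuclideanSpace ℝ (Fin m))
    have h1 := h (x, ξ) v v
    rw [productMetric, rotMetric_apply, rotMetric_apply] at h1
    have h0 : roundMetric ξ (0 : EuclideanSpace ℝ (Fin m)) (0 : EuclideanSpace ℝ (Fin m)) = 0 := by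
      have h00 := (mvfderiv (𝓡 m) ((↑) : UnitSphere m → EuclideanSpace ℝ (Fin (m + 1))) ξ).map_zero
      unfold roundMetric
      erw [h00]
      exact inner_zero_left _
    have h2 : A x * (1 * 1) + A x * roundMetric ξ (0 : EuclideanSpace ℝ (Fin m))
        (0 : EuclideanSpace ℝ (Fin m)) = a * (1 * (1 * 1) + 1 * roundMetric ξ
          (0 : EuclideanSpace ℝ (Fin m)) (0 : EuclideanSpace ℝ (Fin m))) := h1
    rw [h0] at h2
    linarith
  · rintro ⟨a, ha, h⟩
    refine ⟨a, ha, fun p v w => ?_⟩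
    rw [productMetric, rotMetric_apply, rotMetric_apply, h]
    ring

theorem metricInChart_pseudoCylindricMetric (hu : IsPseudoCylindricFactor n T u)
    {e : OpenPartialHomeomorph (Cylinder (n - 1) T) (ModelProd ℝ (EuclideanSpace ℝ (Fin (n - 1))))}
    (he : e ∈ atlas (ModelProd ℝ (EuclideanSpace ℝ (Fin (n - 1)))) (Cylinder (n - 1) T)) :
    metricInChart (cylBasis (n - 1)) (pseudoCylindricMetric hu) e
      = cylMetric (metricFactor n u) :=
  metricInChart_rotMetric _ he

theorem isCylindrical_pseudoCylindricMetric_iff (hu : IsPseudoCylindricFactor n T u) :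
    IsCylindrical (pseudoCylindricMetric hu) ↔ ∃ a, 0 < a ∧ ∀ t, metricFactor n u t = a := by
  rw [pseudoCylindricMetric, isCylindrical_rotMetric_iff]
  simp only [QuotientAddGroup.mk_surjective.forall, metricFactor]
  rfl

theorem hasHarmonicCurvature_pseudoCylindricMetric (hn : 3 ≤ n)
    (hu : IsPseudoCylindricFactor n T u) :
    HasHarmonicCurvature (cylBasis (n - 1)) (pseudoCylindricMetric hu) := by
  intro e he y _ i j k
  rw [metricInChart_pseudoCylindricMetric hu he]
  -- The choice of `q` is dictated by `hasDerivAt_logSlope`, and `q'` is its derivative; the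
  -- required relation follows from `n A = 2 q + (n-2)(1 - p²)`.
  refine divRiemann_cylMetric y (p := logSlope n u)
    (q := fun t => (n : ℝ) / 2 * metricFactor n u t - ((n : ℝ) - 2) / 2 * (1 - logSlope n u t ^ 2))
    (q' := fun t => (n : ℝ) * metricFactor n u t * logSlope n u t
      - (n - 2) * logSlope n u t * ((n : ℝ) / 2 * metricFactor n u t
        - ((n : ℝ) - 2) / 2 * (1 - logSlope n u t ^ 2)))
    (fun t => (hu.metricFactor_pos t).ne') hu.hasDerivAt_metricFactor (hu.hasDerivAt_logSlope hn)
    (fun t => ?_) (fun t => ?_) i j k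
  · refine (((hu.hasDerivAt_metricFactor t).const_mul _).fun_sub
      ((((hu.hasDerivAt_logSlope hn t).fun_pow 2).const_sub 1).const_mul _)).congr_deriv ?_
    push_cast
    ring
  · have hm : ((n - 1 : ℕ) : ℝ) = n - 1 := by
      rw [Nat.cast_sub (by omega), Nat.cast_one]
    rw [hm]
    ring

theorem hasParallelRicci_pseudoCylindricMetric_iff (hn : 3 ≤ n)
    (hu : IsPseudoCylindricFactor n T u) :
    HasParallelRicci (cylBasis (n - 1)) (pseudoCylindricMetric hu) ↔
      IsCylindrical (pseudoCylindricMetric hu) := by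
  have hT : 0 < T := Fact.out
  rw [isCylindrical_pseudoCylindricMetric_iff]
  constructor
  · intro h
    have hp : ∀ t, logSlope n u t = 0 := by
      refine hu.logSlope_eq_zero hn hT fun t => ?_
      let ξ : UnitSphere (n - 1) := ⟨EuclideanSpace.single 0 1, by simp⟩
      let e₂ := chartAt (EuclideanSpace ℝ (Fin (n - 1))) ξ
      let e := (AddCircle.openPartialHomeomorphCoe T (t - T / 2)).symm.prod e₂
      have he : e ∈ atlas (ModelProd ℝ (EuclideanSpace ℝ (Fin (n - 1)))) (Cylinder (n - 1) T) :=
        ⟨_, ⟨_, rfl⟩, _, chart_mem_atlas _ ξ, rfl⟩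
      have hy : ((t, e₂ ξ) : ℝ × EuclideanSpace ℝ (Fin (n - 1))) ∈
          (e.extend (cylModel (n - 1))).target := by
        rw [OpenPartialHomeomorph.extend_prod]
        refine ⟨?_, ?_⟩
        · simp only [OpenPartialHomeomorph.extend_target]
          exact ⟨⟨by simp [hT], show t < t - T / 2 + T by linarith⟩, by simp⟩
        · simp only [OpenPartialHomeomorph.extend_target]
          exact ⟨e₂.map_source (mem_chart_source _ ξ), by simp⟩
      let a : Fin (n - 1) := ⟨0, by omega⟩
      have h1 := h e he _ hy (.inr a) (.inl ()) (.inr a)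
      rw [metricInChart_pseudoCylindricMetric hu he, covDerivRicci_cylMetric_mixed _
        (fun t => (hu.metricFactor_pos t).ne') hu.hasDerivAt_metricFactor
        (hu.hasDerivAt_logSlope hn) a] at h1
      -- The factor `m - 1 = n - 2` of the mixed component is non-zero because `n ≥ 3`.
      have hm : ((n - 1 : ℕ) : ℝ) - 1 ≠ 0 := by
        have : (3 : ℝ) ≤ n := by exact_mod_cast hn
        rw [Nat.cast_sub (by omega), Nat.cast_one]
        linarith
      rcases mul_eq_zero.1 ((mul_eq_zero.1 h1).resolve_right (stereoFactor_pos _).ne') with h2 | h2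
      · exact Or.inl ((mul_eq_zero.1 h2).resolve_left hm)
      · exact Or.inr (sub_eq_zero.1 h2)
    refine ⟨metricFactor n u 0, hu.metricFactor_pos 0, fun t => ?_⟩
    refine is_const_of_deriv_eq_zero
      (fun t => (hu.hasDerivAt_metricFactor t).differentiableAt) (fun t => ?_) t 0
    rw [(hu.hasDerivAt_metricFactor t).deriv, hp, mul_zero]
  · rintro ⟨a, ha, h⟩ e he y _ i j k
    rw [metricInChart_pseudoCylindricMetric hu he, funext h]
    exact covDerivRicci_cylMetric_const y ha.ne' i j k

end Curvature

/-! ### Arclength reparametrization and the induced diffeomorphisms. -/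

/-- The primitive of a smooth positive `T`-periodic function is a diffeomorphism of the line that
intertwines the translations by `T` and by a period `S > 0`. -/
theorem exists_arclength {ρ : ℝ → ℝ} {T : ℝ} (hT : 0 < T) (hρ : ContDiff ℝ ∞ ρ)
    (hpos : ∀ t, 0 < ρ t) (hper : Function.Periodic ρ T) :
    ∃ S, 0 < S ∧ ∃ σ τ : ℝ → ℝ, ContDiff ℝ ∞ σ ∧ ContDiff ℝ ∞ τ ∧ (∀ t, τ (σ t) = t) ∧
      (∀ s, σ (τ s) = s) ∧ (∀ t, σ (t + T) = σ t + S) ∧ (∀ s, τ (s + S) = τ s + T) ∧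
      ∀ s, HasDerivAt τ (ρ (τ s))⁻¹ s := by
  have hS : 0 < ∫ t in (0)..T, ρ t :=
    intervalIntegral.intervalIntegral_pos_of_pos (hρ.continuous.intervalIntegrable _ _) hpos hT
  set S := ∫ t in (0)..T, ρ t
  let σ : ℝ → ℝ := fun t => ∫ s in (0)..t, ρ s
  have hd : ∀ t, HasDerivAt σ (ρ t) t := fun t =>
    (hρ.continuous.integral_hasStrictDerivAt 0 t).hasDerivAt
  have hσ : ContDiff ℝ ∞ σ := by
    rw [contDiff_infty_iff_deriv]
    refine ⟨fun t => (hd t).differentiableAt, ?_⟩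
    rwa [show deriv σ = ρ from funext fun t => (hd t).deriv]
  have hmono : StrictMono σ := strictMono_of_deriv_pos fun t => by
    rw [(hd t).deriv]; exact hpos t
  -- A positive integral over one period forces the primitive to tend to `±∞` at the two ends.
  have hsurj : Function.Surjective σ := hσ.continuous.surjective
    (hper.tendsto_atTop_intervalIntegral_of_pos hS hT)
    (hper.tendsto_atBot_intervalIntegral_of_pos hS hT)
  let f : ℝ ≃ₜ ℝ := (hmono.orderIsoOfSurjective σ hsurj).toHomeomorph
  have h1 : ∀ t, f.symm (σ t) = t := f.symm_apply_apply
  have h2 : ∀ s, σ (f.symm s) = s := f.apply_symm_apply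
  have h3 : ∀ t, σ (t + T) = σ t + S := fun t => by
    have := hper.intervalIntegral_add_eq t 0
    rw [zero_add] at this
    change _ = _ + ∫ t in (0)..T, ρ t
    rw [← this]
    exact (intervalIntegral.integral_add_adjacent_intervals
      (hρ.continuous.intervalIntegrable _ _) (hρ.continuous.intervalIntegrable _ _)).symm
  refine ⟨S, hS, σ, f.symm, hσ, f.contDiff_symm_deriv (fun t => (hpos t).ne') hd hσ, h1, h2, h3,
    fun s => ?_, fun s => ?_⟩
  · apply hmono.injective
    rw [h2, h3, h2]
  · exact (hd _).of_local_left_inverse f.symm.continuous.continuousAt (hpos _).ne'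
      (Filter.Eventually.of_forall h2)

section Diffeo

variable {m : ℕ} {S T : ℝ} [Fact (0 < S)] [Fact (0 < T)] {σ τ : ℝ → ℝ}

/-- The product of a diffeomorphism of circles and of the identity of the sphere. -/
def cylDiffeo (m : ℕ) (Ψ : AddCircle S ≃ₘ⟮𝓘(ℝ, ℝ), 𝓘(ℝ, ℝ)⟯ AddCircle T) :
    Cylinder m S ≃ₘ⟮cylModel m, cylModel m⟯ Cylinder m T :=
  Ψ.prodCongr (Diffeomorph.refl (𝓡 m) (UnitSphere m) ∞)

theorem pullbackMetric_cylDiffeo (Ψ : AddCircle S ≃ₘ⟮𝓘(ℝ, ℝ), 𝓘(ℝ, ℝ)⟯ AddCircle T)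
    (A B : AddCircle T → ℝ) {c : AddCircle S → ℝ}
    (hc : ∀ x, ∀ v : ℝ, (mfderiv 𝓘(ℝ, ℝ) 𝓘(ℝ, ℝ) Ψ x : ℝ → ℝ) v = c x * v) :
    pullbackMetric (cylDiffeo m Ψ) (rotMetric A B)
      = rotMetric (fun x => A (Ψ x) * c x ^ 2) (fun x => B (Ψ x)) := by
  funext p v w
  have h1 := mfderiv_prodMap (p := p) (Ψ.contMDiff.mdifferentiable (by simp) p.1)
    (mdifferentiableAt_id (I := 𝓡 m) (x := p.2))
  rw [mfderiv_id] at h1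
  unfold pullbackMetric
  rw [show (cylDiffeo m Ψ : Cylinder m S → Cylinder m T) = Prod.map Ψ id from rfl, h1,
    rotMetric_apply, rotMetric_apply]
  have key : ∀ a b : ℝ, A (Ψ p.1) * ((show ℝ from (mfderiv 𝓘(ℝ, ℝ) 𝓘(ℝ, ℝ) Ψ p.1 : ℝ → ℝ) a)
      * (show ℝ from (mfderiv 𝓘(ℝ, ℝ) 𝓘(ℝ, ℝ) Ψ p.1 : ℝ → ℝ) b))
      = A (Ψ p.1) * c p.1 ^ 2 * (a * b) := fun a b => by
    rw [hc, hc]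
    ring
  exact congrArg (· + _) (key _ _)

end Diffeo

/-! ### From the equation for `u` to the Derdzinski equation. -/

section Derdzinski

variable {n : ℕ} {T : ℝ} {u : ℝ → ℝ}

/-- The exponent `n/(n-2)` makes the factor `τ' = u^{-2/(n-2)}` cancel, leaving `h' = (n/(n-2))
u'(τ)`. A second derivative then brings in `u''` only, with no `(u')²` term, and the nonlinear term
of the equation for `u` becomes `-(n²/4) h`, whence `C = n`. -/
theorem IsPseudoCylindricFactor.isDerdzinskiFactor (hn : 3 ≤ n)
    (hu : IsPseudoCylindricFactor n T u) {S : ℝ} {τ : ℝ → ℝ} (hτ : ContDiff ℝ ∞ τ)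
    (hτS : ∀ s, τ (s + S) = τ s + T)
    (hd : ∀ s, HasDerivAt τ (u (τ s) ^ (2 / ((n : ℝ) - 2)))⁻¹ s) :
    IsDerdzinskiFactor n n S fun s => u (τ s) ^ ((n : ℝ) / ((n : ℝ) - 2)) := by
  have hn3 : (3 : ℝ) ≤ n := by exact_mod_cast hn
  have hn2 : (n : ℝ) - 2 ≠ 0 := by linarith
  have hn0 : (n : ℝ) ≠ 0 := by linarith
  have hn1 : (n : ℝ) - 1 ≠ 0 := by linarith
  refine ⟨(hu.smooth.comp hτ).rpow_const_of_ne fun s => (hu.pos _).ne',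
    fun s => Real.rpow_pos_of_pos (hu.pos _) _, fun s => by simp only [hτS, hu.periodic (τ s)], ?_⟩
  have e0 : ∀ s x : ℝ, u s * u s ^ x = u s ^ (1 + x) := fun s x => by
    rw [Real.rpow_add (hu.pos s), Real.rpow_one]
  have h1 : deriv (fun s => u (τ s) ^ ((n : ℝ) / ((n : ℝ) - 2)))
      = fun s => (n : ℝ) / ((n : ℝ) - 2) * deriv u (τ s) := by
    funext s
    refine (((hu.hasDerivAt_rpow _ (τ s)).comp s (hd s)).congr_deriv ?_).deriv
    have hp := hu.pos (τ s)
    have : u (τ s) ^ ((n : ℝ) / ((n : ℝ) - 2)) = u (τ s) * u (τ s) ^ (2 / ((n : ℝ) - 2)) := by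
      rw [e0]
      congr 1
      field_simp
      ring
    rw [this]
    have := (Real.rpow_pos_of_pos hp (2 / ((n : ℝ) - 2))).ne'
    field_simp
  intro s
  have h2 : deriv (fun s => (n : ℝ) / ((n : ℝ) - 2) * deriv u (τ s)) s
      = (n : ℝ) / ((n : ℝ) - 2) * (deriv (deriv u) (τ s) * (u (τ s) ^ (2 / ((n : ℝ) - 2)))⁻¹) :=
    (((hu.hasDerivAt_deriv (τ s)).comp s (hd s)).const_mul _).deriv
  rw [h1, h2]
  have hp := hu.pos (τ s)
  have h3 := hu.ode (τ s)
  have e1 : u (τ s) ^ (((n : ℝ) + 2) / ((n : ℝ) - 2))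
      = u (τ s) ^ ((n : ℝ) / ((n : ℝ) - 2)) * u (τ s) ^ (2 / ((n : ℝ) - 2)) := by
    rw [← Real.rpow_add hp, add_div]
  have e2 : (u (τ s) ^ ((n : ℝ) / ((n : ℝ) - 2))) ^ (1 - 4 / (n : ℝ))
      = u (τ s) * (u (τ s) ^ (2 / ((n : ℝ) - 2)))⁻¹ := by
    rw [← Real.rpow_mul hp.le, ← Real.rpow_neg hp.le, e0]
    congr 1
    field_simp
    ring
  have h4 : deriv (deriv u) (τ s) = ((n : ℝ) - 2) ^ 2 / 4 * u (τ s)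
      - (n : ℝ) * ((n : ℝ) - 2) / 4 * (u (τ s) ^ ((n : ℝ) / ((n : ℝ) - 2))
        * u (τ s) ^ (2 / ((n : ℝ) - 2))) := by
    rw [← e1]; linarith
  have := (Real.rpow_pos_of_pos hp (2 / ((n : ℝ) - 2))).ne'
  rw [e2, h4]
  field_simp
  ring

end Derdzinski

end

/-! ### Assembly of the three statements. -/

theorem mainTheorem2 (n : ℕ) (hn : 3 ≤ n) (T : ℝ) [Fact (0 < T)]
    (hT : 2 * Real.pi / Real.sqrt ((n : ℝ) - 2) ≤ T)
    (u : ℝ → ℝ) (hu : IsPseudoCylindricFactor n T u) :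
    HasHarmonicCurvature (cylBasis (n - 1)) (pseudoCylindricMetric hu) ∧
    (HasParallelRicci (cylBasis (n - 1)) (pseudoCylindricMetric hu) ↔
      IsCylindrical (pseudoCylindricMetric hu)) ∧
    ∃ (S : ℝ) (_ : Fact (0 < S)) (C : ℝ) (_ : 0 < C) (h : ℝ → ℝ) (hh : IsDerdzinskiFactor n C S h)
      (F : Cylinder (n - 1) S ≃ₘ⟮cylModel (n - 1), cylModel (n - 1)⟯ Cylinder (n - 1) T),
      IsConformalDiffeo F (derdzinskiMetric hh) (productMetric (n - 1) T) ∧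
      pullbackMetric F (pseudoCylindricMetric hu) = derdzinskiMetric hh ∧
      (¬ IsCylindrical (pseudoCylindricMetric hu) → ∃ s s' : ℝ, h s ≠ h s') := by
  refine ⟨hasHarmonicCurvature_pseudoCylindricMetric hn hu,
    hasParallelRicci_pseudoCylindricMetric_iff hn hu, ?_⟩
  have hn3 : (3 : ℝ) ≤ n := by exact_mod_cast hn
  have hn2 : (n : ℝ) - 2 ≠ 0 := by linarith
  have hn0 : (n : ℝ) ≠ 0 := by linarith
  obtain ⟨S, hS, σ, τ, hσ, hτ, h1, h2, hσT, hτS, hd⟩ := exists_arclength (Fact.out : 0 < T)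
    (hu.smooth.rpow_const_of_ne (p := 2 / ((n : ℝ) - 2)) fun t => (hu.pos t).ne')
    (fun t => Real.rpow_pos_of_pos (hu.pos t) _) (fun t => by simp only [hu.periodic t])
  have : Fact (0 < S) := ⟨hS⟩
  have hh := hu.isDerdzinskiFactor hn hτ hτS hd
  -- The forward map is `τ`, from the circle of length `S` to the one of length `T`; its derivative
  -- is the factor `c` below.
  let Ψ := addCircleDiffeo hτS hσT hτ hσ h2 h1
  let c : AddCircle S → ℝ := fun x => (hu.periodic.lift (Ψ x) ^ (2 / ((n : ℝ) - 2)))⁻¹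
  have hc : ∀ x, ∀ v : ℝ, (mfderiv 𝓘(ℝ, ℝ) 𝓘(ℝ, ℝ) Ψ x : ℝ → ℝ) v = c x * v := by
    intro x v
    obtain ⟨s, rfl⟩ := QuotientAddGroup.mk_surjective x
    exact mfderiv_addCircleMap hτS hτ (hd s) v
  have hB : ∀ s, u (τ s) ^ (4 / ((n : ℝ) - 2))
      = (u (τ s) ^ ((n : ℝ) / ((n : ℝ) - 2))) ^ (4 / (n : ℝ)) := fun s => by
    rw [← Real.rpow_mul (hu.pos _).le]
    congr 1
    field_simp
  -- In arclength `h^{4/n} τ'² = 1`: this normalizes the `dt²` coefficient and also gives the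
  -- conformal factor.
  have hAc : ∀ s, (u (τ s) ^ ((n : ℝ) / ((n : ℝ) - 2))) ^ (4 / (n : ℝ))
      * (u (τ s) ^ (2 / ((n : ℝ) - 2)))⁻¹ ^ 2 = 1 := fun s => by
    have hp := Real.rpow_pos_of_pos (hu.pos (τ s)) (2 / ((n : ℝ) - 2))
    rw [← hB, show 4 / ((n : ℝ) - 2) = 2 / ((n : ℝ) - 2) + 2 / ((n : ℝ) - 2) by ring,
      Real.rpow_add (hu.pos _)]
    field_simp
  refine ⟨S, this, n, by linarith, _, hh, cylDiffeo (n - 1) Ψ, ?_, ?_, ?_⟩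
  -- The product metric pulls back to `c² dt² + dξ²`, which is `c²` times the Derdzinski metric
  -- because `c² h^{4/n} = 1`.
  · refine ⟨fun p => c p.1 ^ 2, ?_, fun p => ?_, fun p v w => ?_⟩
    · have h3 : ContMDiff 𝓘(ℝ, ℝ) 𝓘(ℝ, ℝ) ∞ fun x => c x ^ 2 :=
        contMDiff_of_comp_coe_addCircle (ContDiff.contMDiff
          ((((hu.smooth.comp hτ).rpow_const_of_ne (p := 2 / ((n : ℝ) - 2))
            fun s => (hu.pos _).ne').inv fun s =>
              (Real.rpow_pos_of_pos (hu.pos _) _).ne').pow 2))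
      exact h3.comp contMDiff_fst
    · obtain ⟨s, hs⟩ := QuotientAddGroup.mk_surjective p.1
      have hp := Real.rpow_pos_of_pos (hu.pos (τ s)) (2 / ((n : ℝ) - 2))
      change 0 < c p.1 ^ 2
      rw [← hs]
      exact pow_pos (inv_pos.2 hp) 2
    · rw [productMetric, pullbackMetric_cylDiffeo Ψ _ _ hc, derdzinskiMetric, rotMetric_apply,
        rotMetric_apply]
      obtain ⟨s, hs⟩ := QuotientAddGroup.mk_surjective p.1
      have h3 : hh.periodic.lift p.1 ^ (4 / (n : ℝ)) * c p.1 ^ 2 = 1 := by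
        rw [← hs]; exact hAc s
      rw [mul_add, ← mul_assoc (c p.1 ^ 2) (_ ^ _), mul_comm (c p.1 ^ 2) (_ ^ _), h3]
      ring
  · rw [pseudoCylindricMetric, pullbackMetric_cylDiffeo Ψ _ _ hc, derdzinskiMetric]
    congr 1
    · funext x
      obtain ⟨s, rfl⟩ := QuotientAddGroup.mk_surjective x
      refine Eq.trans ?_ (hAc s)
      rw [← hB]
      rfl
    · funext x
      obtain ⟨s, rfl⟩ := QuotientAddGroup.mk_surjective x
      exact hB s
  · intro hcyl
    by_contra! hconst
    refine hcyl ((isCylindrical_pseudoCylindricMetric_iff hu).2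
      ⟨_, hu.metricFactor_pos 0, fun t => ?_⟩)
    -- Every `t` equals `τ (σ t)`, so a constant `h` makes `u^{4/(n-2)}` constant on the whole line.
    rw [IsPseudoCylindricFactor.metricFactor, IsPseudoCylindricFactor.metricFactor, ← h1 t, ← h1 0,
      hB, hB, hconst]
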